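/- **Setting.** $A$ (users) and $M$ (arms) are finite and non-empty. User $j$ has observable covariates $\mathbf x_j\in\mathbb R^k$ and unobservable covariates $\mathbf y_j$. The $n$-th pull of arm $m$ by user $j$ gives the reward $\mu_{j,m}+\epsilon_{j,m}(n)$ with $\mu_{j,m}=\phi_m(\mathbf x_j)'\beta_m+\psi_m(\mathbf y_j)'\lambda_m$, $\phi_m(\mathbf x_j)\in\mathbb R^d$, where the noises are i.i.d., centred, $1$-sub-Gaussian and independent of the arrivals. Put $\Delta_{j,m}=\max_n\mu_{j,n}-\mu_{j,m}$, and let $A_m$ be the set of users whose (unique) optimal arm is $m$. Users arrive one at a time, finitely often in bounded time, and each of them infinitely often; the arrival processes of different users are independent. $S_j(n)$ is the time of the $n$-th arrival of $j$, $F_j^{(n)}$ its law, and $N_j(t)$ the number of arrivals of $j$ until $t$. **Mechanism.** At each time $A_+$ is the set of users who are opted in. When $j\in A_+$ arrives at time $t$ and at least $d$ other users are opted in, the recommender takes, for each arm $m$, a set $E$ of $d$ users of $A_+\setminus\{j\}$ with the largest numbers $N_{i,m}$ of reported pulls of $m$ (ties broken in any way), obtains coefficients $(a_{ji})_{i\in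 E}$ from a synthetic control oracle that is given the covariates and reported reward histories of $E\cup\{j\}$, and sends $j$ $$ucb^{cf}_{j,m}=\sum_{i\in E}a_{ji}\overline Y_{i,m}+\sum_{i\in E}|a_{ji}|\sqrt{\frac{2\ln d+4\ln N_j(t)}{\min_{i\in E}N_{i,m}}},$$ where $\overline Y_{i,m}$ is the mean of the rewards that $i$ has reported for $m$ ($ucb^{cf}_{j,m}=+\infty$ if there are fewer than $d$ such users or the minimum is $0$). From her own experience, with $N_{j,m}$ own pulls of $m$ with mean reward $\overline Y_{j,m}$, user $j$ computes $ucb^{se}_{j,m}=\overline Y_{j,m}+\sqrt{4\ln N_j(t)/N_{j,m}}$ ($+\infty$ if $N_{j,m}=0$). *Oracle assumption:* whenever $j\notin E$ and $\{\phi_m(\mathbf x_i)\}_{i\in E}$ has rank at least $d$, the oracle's output satisfies $\mu_{j,m}=\sum_{i\in E}a_{ji}\mu_{i,m}$. Any $d$ distinct users have $\{\phi_m(\mathbf x_i)\}$ of rank $d$, and $\sum_{i\in E}|a_{ji}|\le c_{j,m}$ for all outputs with $|E|=d$, $j\notin E$, where $c_{j,m}>0$ are constants. **Arrival assumption (all users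 opted in).** For $i\neq j$ put $q_{ij,m}(x)=-B\,\mathcal W_{-1}\!\left(-\tfrac1B(x/d)^{-C/B}\right)$ with $B=\sum_{n\ne m}16/\Delta_{i,n}^2$, $C=16c_{j,m}^2/\Delta_{j,m}^2$ and $\mathcal W_{-1}$ the lower branch of the Lambert function (read as $0$ outside $[-1/e,0)$), and let $$E_{j,m}=\Big\{i\ne j:\ \limsup_{n\to\infty} n^2\int_0^\infty P\big(N_i(t)<q_{ij,m}(N_j(t))\big)\,dF_j^{(n)}(t)<\infty\Big\}.$$ Then $|E_{j,m}\cap A_m|\ge d$ for every user $j$ and every arm $m$ with $\Delta_{j,m}>0$. **Game.** At the beginning all users choose simultaneously whether to opt in. Each arrival is one stage: the arriving user chooses whether to be opted in from now until her next arrival; if she is, she receives $(ucb^{cf}_{j,m})_{m\in M}$; she pulls an arm and observes the reward; she makes a report of an arm and a reward, which reaches the recommender only if she is opted in. A user's choices may depend on everything she has observed. A *complying* strategy always opts in, always pulls an arm maximizing $\min(ucb^{se}_{j,m},ucb^{cf}_{j,m})$ (ties broken in any way) and always reports truthfully, also after histories in which it was not followed before. The regret of user $j$ up to $T$ is the sum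 of $\Delta_{j,m}$ over her pulls up to time $T$. Preferences are *asymptotically indifferent*: a user weakly prefers expected regret $f(T)$ to $g(T)$ if and only if $f=O(\max(1,g))$ as $T\to\infty$, so bounded regret is the smallest order. **Theorem.** Under these assumptions, if all users have asymptotically indifferent preferences, every profile in which every user follows a complying strategy is a subgame perfect Nash equilibrium: in the whole game, and in the subgame after any initial opt-in decisions and any finite sequence of completed stages (any choices and rewards, and almost every realization of the arrivals so far, starting just before or just after the next arrival), every user weakly prefers her expected regret under the profile to her expected regret under any unilateral deviation of hers. Moreover, in the whole game and in each of these subgames, every user's expected regret under the profile is bounded uniformly in $T$, that is $O(1)$. -/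

import Mathlib

open MeasureTheory ProbabilityTheory Filter
open scoped ENNReal NNReal

namespace CFUCB

noncomputable section

/-! ### The environment: users, arms, mean rewards -/

/-- Users `A`, arms `M`. User `j` has observable covariates `x j` and unobservable covariates `y j`;
arm `m` has representation maps `φ m`, `ψ m` and parameters `β m`, `lam m`. -/
structure Environment (A M : Type) (k k' d d' : ℕ) where
  x : A → Fin k → ℝ
  y : A → Fin k' → ℝ
  φ : M → (Fin k → ℝ) → (Fin d → ℝ)
  ψ : M → (Fin k' → ℝ) → (Fin d' → ℝ)
  β : M → Fin d → ℝ
  lam : M → Fin d' → ℝ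

namespace Environment

variable {A M : Type} {k k' d d' : ℕ} (env : Environment A M k k' d d')

/-- Mean reward of user `j` from arm `m`: `φ_m(x_j)' β_m + ψ_m(y_j)' λ_m`. -/
def mean (j : A) (m : M) : ℝ :=
  (∑ l, env.φ m (env.x j) l * env.β m l) + ∑ l, env.ψ m (env.y j) l * env.lam m l

/-- The gap `Δ_{j,m}`: mean reward of an optimal arm minus that of arm `m`. -/
def gap (j : A) (m : M) : ℝ := (⨆ n, env.mean j n) - env.mean j m

/-- Any `d` distinct users have representation vectors of full rank `d`, for every arm. -/
def GeneralPosition : Prop :=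
  ∀ (m : M) (E : Finset A), E.card = d →
    Set.finrank ℝ ((fun i => env.φ m (env.x i)) '' (E : Set A)) = d

end Environment

/-! ### Histories of the game -/

/-- What happens in one stage: the arrival of `user` at `time`; whether she is opted in at this
arrival; the vector of counterfactual upper confidence bounds she is sent (`none` if she is opted
out); the arm she pulls; the reward she gets; the report (arm, reward) she makes, which reaches the
recommender only if she is opted in. -/
structure Record (A M : Type) where
  user : A
  time : ℝ
  optIn : Bool
  signal : Option (M → EReal)
  arm : M
  reward : ℝ
  report : M × ℝ

/-- A finite history: the completed stages, most recent first. -/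
abbrev History (A M : Type) := List (Record A M)

/-- What the recommender learns in one stage: who arrived when, and the report if the user is
opted in. -/
abbrev PubRecord (A M : Type) := A × ℝ × Option (M × ℝ)

def Record.pub {A M : Type} (r : Record A M) : PubRecord A M :=
  (r.user, r.time, if r.optIn then some r.report else none)

section Recommender

variable {A M : Type} [Fintype A] [DecidableEq A] [DecidableEq M]

/-- Whether user `i` is currently opted in: her choice at her latest arrival, or her choice at the
beginning of the game (`o i`) if she has not arrived yet. -/
def optedIn (o : A → Bool) (H : List (PubRecord A M)) (i : A) : Bool :=
  match H.find? (fun r => decide (r.1 = i)) with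
  | some r => r.2.2.isSome
  | none => o i

/-- The users other than `j` who are currently opted in. -/
def others (o : A → Bool) (H : List (PubRecord A M)) (j : A) : Finset A :=
  Finset.univ.filter fun i => i ≠ j ∧ optedIn o H i = true

/-- The history of the rewards that user `i` has reported for arm `m`. -/
def reports (H : List (PubRecord A M)) (i : A) (m : M) : List ℝ :=
  H.filterMap fun r =>
    match r.2.2 with
    | some p => if r.1 = i ∧ p.1 = m then some p.2 else none
    | none => none

/-- Number of reported pulls of arm `m` by user `i`. -/
def cnt (H : List (PubRecord A M)) (i : A) (m : M) : ℕ := (reports H i m).length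

/-- Empirical mean of a list of rewards. -/
def listMean (l : List ℝ) : ℝ := l.sum / l.length

/-- Number of arrivals of user `j` up to and including the arrival that follows history `H`. -/
def arrivalNo (H : List (PubRecord A M)) (j : A) : ℕ :=
  (H.filter fun r => decide (r.1 = j)).length + 1

/-- The data of the recommendation mechanism. `sco` is the synthetic control oracle: from the arm
`m`, the user `j`, the set `E`, the observable covariates and the reward histories of `E ∪ {j}` it
computes coefficients `a_{ji}`, `i ∈ E`. `sel` chooses, from the information of the recommender,
the users from whose experience the counterfactual bound for user `j` and arm `m` is made. -/
structure Mechanism (A M : Type) (k : ℕ) where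
  sco : M → A → Finset A → (A → Fin k → ℝ) → (A → List ℝ) → A → ℝ
  sel : (A → Bool) → List (PubRecord A M) → A → M → Finset A

variable {k k' d d' : ℕ}

namespace Mechanism

variable (Γ : Mechanism A M k) (env : Environment A M k k' d d')

/-- The coefficients returned by the oracle, which is only shown the data of `E ∪ {j}`. -/
def coef (m : M) (j : A) (E : Finset A) (h : A → List ℝ) (i : A) : ℝ :=
  Γ.sco m j E (fun i' => if i' ∈ insert j E then env.x i' else 0)
    (fun i' => if i' ∈ insert j E then h i' else []) i

/-- Synthetic control oracle assumption: whenever the representation vectors of the users in `E`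
have rank at least `d`, the output satisfies `μ_{j,m} = ∑_{i ∈ E} a_{ji} μ_{i,m}`. -/
def SCOAssumption : Prop :=
  ∀ (m : M) (E : Finset A) (j : A), j ∉ E →
    d ≤ Set.finrank ℝ ((fun i => env.φ m (env.x i)) '' (E : Set A)) →
    ∀ h : A → List ℝ, env.mean j m = ∑ i ∈ E, Γ.coef env m j E h i * env.mean i m

/-- `c j m` bounds the `ℓ¹` norm of the coefficients the oracle can return for user `j` and arm `m`
from a set of `d` other users. -/
def CoefBound (c : A → M → ℝ) : Prop :=
  ∀ (j : A) (m : M) (E : Finset A), j ∉ E → E.card = d →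
    ∀ h : A → List ℝ, ∑ i ∈ E, |Γ.coef env m j E h i| ≤ c j m

/-- If at least `d` users other than `j` are opted in, `sel` consists of `d` of them with the largest
numbers of reported pulls of arm `m` (ties broken in any way). -/
def ValidSelection (d : ℕ) (Γ : Mechanism A M k) : Prop :=
  ∀ (o : A → Bool) (H : List (PubRecord A M)) (j : A) (m : M), d ≤ (others o H j).card →
    Γ.sel o H j m ⊆ others o H j ∧ (Γ.sel o H j m).card = d ∧
      ∀ i ∈ Γ.sel o H j m, ∀ i' ∈ others o H j, i' ∉ Γ.sel o H j m → cnt H i' m ≤ cnt H i m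

/-- The counterfactual upper confidence bound of user `j`, who arrives right after history `H`, for
arm `m`. It is `+∞` if fewer than `d` other users are opted in or if one of the selected users has
not reported arm `m` yet. -/
def ucbcf (o : A → Bool) (H : List (PubRecord A M)) (j : A) (m : M) : EReal :=
  if d ≤ (others o H j).card then
    let E := Γ.sel o H j m
    let a := Γ.coef env m j E (fun i => reports H i m)
    let Nmin : ℕ := sInf ((fun i => cnt H i m) '' (E : Set A))
    if Nmin = 0 then ⊤
    else (((∑ i ∈ E, a i * listMean (reports H i m)) +
      (∑ i ∈ E, |a i|) *
        Real.sqrt ((2 * Real.log d + 4 * Real.log (arrivalNo H j)) / Nmin) : ℝ) : EReal)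
  else ⊤

end Mechanism

/-! ### Strategies -/

/-- A (pure) strategy of a user. `init` is the choice at the beginning of the game whether to opt in.
At each arrival she knows her initial choice, the records `own` of her own earlier stages and the
current time, and chooses in turn whether to be opted in, the arm to pull (knowing the signal she
received, if any), and the report (knowing also the arm pulled and the reward). -/
structure Strategy (A M : Type) where
  init : Bool
  opt : Bool → List (Record A M) → ℝ → Bool
  arm : Bool → List (Record A M) → ℝ → Option (M → EReal) → M
  report : Bool → List (Record A M) → ℝ → Option (M → EReal) → M → ℝ → M × ℝ

/-- A user's own rewards from arm `m`, from the records of her own stages. -/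
def ownRewards (own : List (Record A M)) (m : M) : List ℝ :=
  (own.filter fun r => decide (r.arm = m)).map Record.reward

/-- The self-experience based upper confidence bound at the arrival following `own`. -/
def ucbse (own : List (Record A M)) (m : M) : EReal :=
  let N := (ownRewards own m).length
  if N = 0 then ⊤
  else ((listMean (ownRewards own m) +
    Real.sqrt (4 * Real.log ((own.length + 1 : ℕ) : ℝ) / N) : ℝ) : EReal)

/-- The index of the arm: the smaller of the two upper confidence bounds. -/
def ucb (own : List (Record A M)) (signal : Option (M → EReal)) (m : M) : EReal :=
  match signal with
  | some u => min (ucbse own m) (u m)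
  | none => ucbse own m

/-- The strategy of always opting in and complying: at every own history the user opts in, pulls an
arm of maximal index (ties broken in any way) and reports truthfully. -/
def Strategy.Complies (s : Strategy A M) : Prop :=
  s.init = true ∧
  (∀ o own t, s.opt o own t = true) ∧
  (∀ o own t signal m, ucb own signal m ≤ ucb own signal (s.arm o own t signal)) ∧
  (∀ o own t signal m r, s.report o own t signal m r = (m, r))

/-! ### Play -/

/-- A path of the arrival process: the user and the time of the first, second, ... arrival. -/
abbrev ArrivalPath (A : Type) := ℕ → A × ℝ

variable (env : Environment A M k k' d d') (Γ : Mechanism A M k)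

/-- The records of the stages at which user `i` arrived. -/
def ownRecords (h : History A M) (i : A) : List (Record A M) :=
  h.filter fun r => decide (r.user = i)

/-- The stage following history `h`, when the arrival is `p`. The reward of the `n`-th pull of arm
`m` by user `j` is `μ_{j,m}` plus the noise `ε (j, m, n)` (with `n` counted from `0`). -/
def stage (s : A → Strategy A M) (o : A → Bool) (ε : A × M × ℕ → ℝ) (h : History A M)
    (p : A × ℝ) : Record A M :=
  let i := p.1
  let t := p.2
  let own := ownRecords h i
  let b := (s i).opt (o i) own t
  let signal : Option (M → EReal) :=
    if b then some (Γ.ucbcf env o (h.map Record.pub) i) else none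
  let m := (s i).arm (o i) own t signal
  let r := env.mean i m + ε (i, m, (ownRewards own m).length)
  ⟨i, t, b, signal, m, r, (s i).report (o i) own t signal m r⟩

/-- The history `n` stages after `h`, when profile `s` is played from `h` on. -/
def play (s : A → Strategy A M) (o : A → Bool) (ε : A × M × ℕ → ℝ) (x : ArrivalPath A)
    (h : History A M) : ℕ → History A M
  | 0 => h
  | n + 1 => stage env Γ s o ε (play s o ε x h n) (x (h.length + n)) :: play s o ε x h n

/-- The regret of user `i` up to time `T` over the stages that follow history `h`. -/
def regret (s : A → Strategy A M) (o : A → Bool) (ε : A × M × ℕ → ℝ) (x : ArrivalPath A)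
    (h : History A M) (i : A) (T : ℝ) : ℝ≥0∞ :=
  ∑' n : ℕ,
    let r := stage env Γ s o ε (play env Γ s o ε x h n) (x (h.length + n))
    if r.user = i ∧ r.time ≤ T then ENNReal.ofReal (env.gap i r.arm) else 0

/-- Expected regret, when the arrival path has law `Q` and the noises are i.i.d. with law `ν`,
independent of the arrivals. -/
def expRegret [MeasurableSpace A] (Q : Measure (ArrivalPath A)) (ν : Measure ℝ)
    [IsProbabilityMeasure ν] (s : A → Strategy A M) (o : A → Bool) (h : History A M) (i : A)
    (T : ℝ) : ℝ≥0∞ :=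
  ∫⁻ z, regret env Γ s o z.2 z.1 h i T ∂(Q.prod (Measure.infinitePi fun _ : A × M × ℕ => ν))

/-- Histories that can occur: the signals are those sent by the mechanism. -/
def Feasible (o : A → Bool) : History A M → Prop
  | [] => True
  | r :: h =>
      r.signal = (if r.optIn then some (Γ.ucbcf env o (h.map Record.pub) r.user) else none) ∧
      Feasible o h

/-- The users and times of the arrivals in the history are the first terms of the finite sequence `p`
of arrivals, and `p` contains at most one more arrival. So the subgame starts right before or right
after the arrival of the user who moves next. -/
def Follows {l : ℕ} (p : Fin l → A × ℝ) (h : History A M) : Prop :=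
  h.length ≤ l ∧ l ≤ h.length + 1 ∧
    (h.map fun r => (r.user, r.time)).reverse = (List.ofFn p).take h.length

/-- The law of the arrival path given the first `l` arrivals. -/
def condArrivals [Nonempty A] [MeasurableSpace A] [DiscreteMeasurableSpace A]
    (P : Measure (ArrivalPath A)) [IsProbabilityMeasure P] (l : ℕ) :
    Kernel (Fin l → A × ℝ) (ArrivalPath A) :=
  condDistrib (fun x : ArrivalPath A => x) (fun x (n : Fin l) => x n) P

/-! ### Preferences and equilibrium -/

/-- A preference over regrets as functions of the horizon: `pref f g` means that regret `f` is weakly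
preferred to regret `g`. -/
abbrev Preference := (ℝ → ℝ≥0∞) → (ℝ → ℝ≥0∞) → Prop

/-- Asymptotically indifferent preferences: `f` is weakly preferred to `g` if and only if the order of
`f` is at most that of `g`, as `T → ∞`, where bounded regret is the smallest order. -/
def AsymptoticallyIndifferent (pref : Preference) : Prop :=
  ∀ f g, pref f g ↔ ∃ K : ℝ≥0, ∀ᶠ T in atTop, f T ≤ K * max 1 (g T)

/-- `s` is a Nash equilibrium of the whole game: no user gains from a unilateral deviation. The game
includes the simultaneous choice of the initial opt-in decisions. -/
def IsNash [MeasurableSpace A] (P : Measure (ArrivalPath A)) (ν : Measure ℝ)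
    [IsProbabilityMeasure ν] (pref : A → Preference) (s : A → Strategy A M) : Prop :=
  ∀ (i : A) (dev : Strategy A M),
    pref i (expRegret env Γ P ν s (fun j => (s j).init) [] i)
      (expRegret env Γ P ν (Function.update s i dev)
        (fun j => (Function.update s i dev j).init) [] i)

/-- `s` is a Nash equilibrium of the subgame after initial opt-in decisions `o` and history `h`, when
`Q` is the conditional law of the arrivals. -/
def IsNashAt [MeasurableSpace A] (Q : Measure (ArrivalPath A)) (ν : Measure ℝ)
    [IsProbabilityMeasure ν] (pref : A → Preference) (s : A → Strategy A M) (o : A → Bool)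
    (h : History A M) : Prop :=
  ∀ (i : A) (dev : Strategy A M),
    pref i (expRegret env Γ Q ν s o h i)
      (expRegret env Γ Q ν (Function.update s i dev) o h i)

/-- A property of subgames (given by the conditional law of the arrivals, the initial opt-in decisions
and the history) holds in all subgames after the initial decisions: for almost all realizations of
the exogenous arrivals and all choices and rewards so far. -/
def InEverySubgame [Nonempty A] [MeasurableSpace A] [DiscreteMeasurableSpace A]
    (P : Measure (ArrivalPath A)) [IsProbabilityMeasure P]
    (C : Measure (ArrivalPath A) → (A → Bool) → History A M → Prop) : Prop :=
  ∀ l : ℕ, ∀ᵐ p ∂(P.map fun (x : ArrivalPath A) (n : Fin l) => x n),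
    ∀ (o : A → Bool) (h : History A M), Feasible env Γ o h → Follows p h →
      C (condArrivals P l p) o h

/-- Subgame perfect Nash equilibrium. -/
def IsSPNE [Nonempty A] [MeasurableSpace A] [DiscreteMeasurableSpace A]
    (P : Measure (ArrivalPath A)) [IsProbabilityMeasure P] (ν : Measure ℝ)
    [IsProbabilityMeasure ν] (pref : A → Preference) (s : A → Strategy A M) : Prop :=
  IsNash env Γ P ν pref s ∧
  InEverySubgame env Γ P fun Q o h => IsNashAt env Γ Q ν pref s o h

end Recommender

/-! ### Arrivals -/

section Arrivals

variable {A : Type}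

/-- `S_j(n)`: the time of the `n`-th arrival of user `j`, `n ≥ 1`. -/
def arrivalTime (j : A) (n : ℕ) (x : ArrivalPath A) : ℝ :=
  (x (Nat.nth (fun l => (x l).1 = j) (n - 1))).2

/-- `N_j(t)`: the number of arrivals of user `j` until time `t`. -/
def arrivals (j : A) (t : ℝ) (x : ArrivalPath A) : ℕ :=
  Set.ncard {l | (x l).1 = j ∧ (x l).2 ≤ t}

/-- Arrivals occur one at a time, finitely often in bounded time, and every user keeps arriving. -/
def ArrivalPath.Regular (x : ArrivalPath A) : Prop :=
  0 ≤ (x 0).2 ∧ StrictMono (fun l => (x l).2) ∧ Tendsto (fun l => (x l).2) atTop atTop ∧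
    ∀ j : A, {l | (x l).1 = j}.Infinite

/-- The arrival processes of the different users are independent. -/
def IndependentArrivals [MeasurableSpace A] (P : Measure (ArrivalPath A)) : Prop :=
  iIndepFun (fun (j : A) (x : ArrivalPath A) (n : ℕ) => arrivalTime j (n + 1) x) P

/-- The lower branch `W₋₁` of the Lambert function on `[-1/e, 0)` (and `0` elsewhere). -/
def lambertWm1 (z : ℝ) : ℝ := sInf {w : ℝ | w ≤ -1 ∧ w * Real.exp w = z}

/-- `-B W₋₁(-(1/B) (x/d)^(-C/B))`. -/
def qFun (d : ℕ) (B C x : ℝ) : ℝ := -B * lambertWm1 (-(1 / B) * (x / d) ^ (-(C / B)))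

variable {M : Type} [Fintype M] [DecidableEq M] {k k' d d' : ℕ}

/-- `q_{ij,m}`, with `B = ∑_{n ≠ m} 16 / Δ_{i,n}²` and `C = 16 c_{j,m}² / Δ_{j,m}²`. -/
def qijm (env : Environment A M k k' d d') (c : A → M → ℝ) (i j : A) (m : M) (x : ℝ) : ℝ :=
  qFun d (∑ n ∈ Finset.univ.erase m, 16 / env.gap i n ^ 2)
    (16 * c j m ^ 2 / env.gap j m ^ 2) x

/-- `E_{j,m}`: the users `i ≠ j` with
`limsup_n (∫ P(N_i(t) < q_{ij,m}(N_j(t))) dF_j^{(n)}(t)) / (1/n²) < ∞`,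
where `F_j^{(n)}` is the law of `S_j(n)`. -/
def comparable [MeasurableSpace A] (env : Environment A M k k' d d') (c : A → M → ℝ)
    (P : Measure (ArrivalPath A)) (j : A) (m : M) : Set A :=
  {i | i ≠ j ∧
    limsup (fun n : ℕ =>
      (∫⁻ t, P {x | (arrivals i t x : ℝ) < qijm env c i j m (arrivals j t x)}
        ∂(P.map (arrivalTime j n))) / (1 / (n : ℝ≥0∞) ^ 2)) atTop < ⊤}

/-- `A_m`: the users whose optimal arm is `m`. -/
def optimalFor (env : Environment A M k k' d d') (m : M) : Set A :=
  {i | ∀ n, n ≠ m → env.mean i n < env.mean i m}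

/-- The arrival assumption when all users are opted in: `|E_{j,m} ∩ A_m| ≥ d` for every user `j` and
every arm `m` that is not optimal for `j` (so that `q_{ij,m}` is defined). -/
def ArrivalAssumption [MeasurableSpace A] (env : Environment A M k k' d d') (c : A → M → ℝ)
    (P : Measure (ArrivalPath A)) : Prop :=
  ∀ (j : A) (m : M), 0 < env.gap j m →
    d ≤ (comparable env c P j m ∩ optimalFor env m).ncard

end Arrivals

end

end CFUCB

/-! Bounded regret is the smallest order under asymptotically indifferent preferences, so nothing
can improve on it (`AsymptoticallyIndifferent.pref_of_bounded`). Deviations need no analysis: both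
claims follow from `bounded_expRegret`, which bounds expected regret under the complying profile,
initially and after almost every realization of the first arrivals.

Noise. With level `L = log n` at a user's `n`-th arrival, all partial sums of the noise after the
history stay below `4/5 * √(4 k L) + η k`, except on an event of probability `O(n ^ (-32/25))`. The
slack `η k` makes the union over all `k` cost only a constant, so the expected number of bad levels
is finite. Past rewards and possibly false past reports contribute a fixed bias, negligible once `L`
is large.

Decisions. When the noise is under control, the index of an optimal arm is almost at least its mean.
If `j` pulls a suboptimal arm `m` at her `n`-th arrival, the self-experience bound forces `N_{j,m} ≤
(16 / Δ ^ 2) log n`, and the counterfactual bound forces any `d` other opted-in users to include one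
with at most `(9/10) C log n` reports of `m`, where `C = 16 c ^ 2 / Δ ^ 2`. A user with optimal arm
`m` pulls other arms only logarithmically often in her own arrivals. So either one of `d` comparison
users has arrived fewer than `(19/20) C log n` times, or `log n` is bounded by the random burn-in
time (`late_or_log_le_of_pull`). In both cases the self-experience bound limits the number of such
pulls.

Arrivals. Since `q_{ij,m}(x) ≥ C log x` for large `x`, the arrival assumption controls lateness, but
at an independent copy of the arrival time of `j`. Returning to the true time costs a square root
(`sq_measure_lt_le`): the rate `1 / n ^ 2` becomes `1 / n`. That is not summable over `n`, but it is
over the dyadic `n = 2 ^ r`, even with the weight `r + 2` that accounts for the pulls within a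
dyadic block.

Subgames. The pathwise bound on pulls holds after every history, and a variable integrable under `P`
is integrable under almost every conditional law. -/

namespace CFUCB

set_option linter.unusedSectionVars false

/-! ### Concentration of the noise -/

section Noise

variable {A M : Type}

/-- All partial sums of the noises, for user `i` and arm `m` started at index `a i m`, are small at
confidence level `L`. -/
def Concentrated (a : A → M → ℕ) (η L : ℝ) (ε : A × M × ℕ → ℝ) : Prop :=
  ∀ i m (k : ℕ), |∑ t ∈ Finset.range k, ε (i, m, a i m + t)| ≤ 4 / 5 * √(4 * k * L) + η * k

lemma Concentrated.mono {a : A → M → ℕ} {η L L' : ℝ} {ε : A × M × ℕ → ℝ}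
    (h : Concentrated a η L ε) (hL : L ≤ L') : Concentrated a η L' ε := fun i m k =>
  (h i m k).trans (by gcongr)

lemma measurableSet_concentrated [Countable A] [Countable M] (a : A → M → ℕ) (η L : ℝ) :
    MeasurableSet {ε | Concentrated a η L ε} := by
  simp only [Concentrated, Set.ofPred_forall]
  exact MeasurableSet.iInter fun i => MeasurableSet.iInter fun m => MeasurableSet.iInter fun k =>
    measurableSet_le (by fun_prop) measurable_const

lemma measure_abs_sum_noise_gt_le {ι : Type*} (ν : Measure ℝ) [IsProbabilityMeasure ν]
    (hν : HasSubgaussianMGF (fun e : ℝ => e) 1 ν) {e : ℕ → ι} (he : Function.Injective e) (k : ℕ)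
    {u : ℝ} (hu : 0 ≤ u) :
    (Measure.infinitePi fun _ : ι => ν) {ε | u < |∑ t ∈ Finset.range k, ε (e t)|} ≤
      ENNReal.ofReal (2 * Real.exp (-u ^ 2 / (2 * k))) := by
  set μ := Measure.infinitePi fun _ : ι => ν
  have hind : iIndepFun (fun (i : ι) (ω : ι → ℝ) => ω i) μ :=
    iIndepFun_infinitePi (X := fun _ x => x) (by fun_prop)
  have hsub : ∀ i : ι, HasSubgaussianMGF (fun ω : ι → ℝ => ω i) 1 μ := by
    intro i
    have hm : μ.map (fun ω : ι → ℝ => ω i) = ν := Measure.infinitePi_map_eval _ i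
    exact HasSubgaussianMGF.of_map (Y := fun ω : ι → ℝ => ω i) (X := fun e : ℝ => e)
      (measurable_pi_apply i).aemeasurable (by rwa [hm])
  have hind' := hind.precomp he
  have hsum : HasSubgaussianMGF (fun ω : ι → ℝ => ∑ t ∈ Finset.range k, ω (e t)) k μ := by
    have := HasSubgaussianMGF.sum_of_iIndepFun hind' (c := fun _ => 1) (s := Finset.range k)
      fun i _ => hsub (e i)
    simpa using this
  have h1 := hsum.measure_ge_le hu
  have h2 := hsum.neg.measure_ge_le hu
  have hss : {ε : ι → ℝ | u < |∑ t ∈ Finset.range k, ε (e t)|} ⊆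
      {ε | u ≤ ∑ t ∈ Finset.range k, ε (e t)} ∪
        {ε | u ≤ (-fun ω : ι → ℝ => ∑ t ∈ Finset.range k, ω (e t)) ε} := by
    intro ε hε
    rcases lt_abs.1 (show u < |_| from hε) with h | h
    · exact Or.inl h.le
    · exact Or.inr h.le
  have h3 : μ.real {ε | u < |∑ t ∈ Finset.range k, ε (e t)|} ≤
      2 * Real.exp (-u ^ 2 / (2 * k)) := by
    refine (measureReal_mono hss).trans ((measureReal_union_le _ _).trans ?_)
    have : ((k : ℝ≥0) : ℝ) = k := by simp
    rw [this] at h1 h2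
    linarith
  rw [← ENNReal.ofReal_toReal (measure_ne_top μ _)]
  exact ENNReal.ofReal_le_ofReal h3

/-- A union bound over users, arms and all sample sizes `k`. The drift `η * k` supplies a geometric
factor in `k`, and the square-root term supplies the decay in `L`. -/
lemma measure_not_concentrated_le [Fintype A] [Fintype M] (ν : Measure ℝ) [IsProbabilityMeasure ν]
    (hν : HasSubgaussianMGF (fun e : ℝ => e) 1 ν) (a : A → M → ℕ) {η L : ℝ} (hη : 0 < η)
    (hL : 0 ≤ L) :
    (Measure.infinitePi fun _ : A × M × ℕ => ν) {ε | ¬ Concentrated a η L ε} ≤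
      ENNReal.ofReal (Fintype.card (A × M) * (2 * ∑' k : ℕ, Real.exp (-η ^ 2 / 2) ^ k) *
        Real.exp (-(32 / 25) * L)) := by
  set μ := Measure.infinitePi fun _ : A × M × ℕ => ν
  have hr0 : 0 ≤ Real.exp (-η ^ 2 / 2) := (Real.exp_pos _).le
  have hr1 : Real.exp (-η ^ 2 / 2) < 1 := by
    rw [Real.exp_lt_one_iff]; nlinarith [sq_pos_of_pos hη]
  have hsum := summable_geometric_of_lt_one hr0 hr1
  have hss : {ε | ¬ Concentrated a η L ε} ⊆ ⋃ p : A × M, ⋃ k : ℕ,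
      {ε | 4 / 5 * √(4 * k * L) + η * k < |∑ t ∈ Finset.range k, ε (p.1, p.2, a p.1 p.2 + t)|} := by
    intro ε hε
    simp only [Concentrated, Set.mem_ofPred_eq, not_forall, not_le] at hε
    obtain ⟨i, m, k, h⟩ := hε
    exact Set.mem_iUnion.2 ⟨(i, m), Set.mem_iUnion.2 ⟨k, h⟩⟩
  have hterm : ∀ (p : A × M) (k : ℕ),
      μ {ε | 4 / 5 * √(4 * k * L) + η * k < |∑ t ∈ Finset.range k, ε (p.1, p.2, a p.1 p.2 + t)|} ≤
        ENNReal.ofReal (2 * Real.exp (-(32 / 25) * L) * Real.exp (-η ^ 2 / 2) ^ k) := by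
    intro p k
    have hinj : Function.Injective fun t : ℕ => (p.1, p.2, a p.1 p.2 + t) := by
      intro s t h; simpa using h
    rcases Nat.eq_zero_or_pos k with rfl | hk
    · simp
    refine (measure_abs_sum_noise_gt_le ν hν hinj k (by positivity)).trans
      (ENNReal.ofReal_le_ofReal ?_)
    -- The cross term of the squared threshold is dropped. The remaining squares, divided by `2 *
    -- k`, are `(16/25) * 4 * L / 2 = (32/25) * L` and `η ^ 2 * k / 2`.
    rw [mul_assoc 2 (Real.exp _), ← Real.exp_nat_mul, ← Real.exp_add]
    gcongr
    have hk' : (0 : ℝ) < k := by exact_mod_cast hk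
    have hs : √(4 * k * L) ^ 2 = 4 * k * L := Real.sq_sqrt (by positivity)
    have hs0 := Real.sqrt_nonneg (4 * k * L)
    rw [div_le_iff₀ (by positivity)]
    have : 0 ≤ √(4 * k * L) * (η * k) := by positivity
    nlinarith
  calc μ {ε | ¬ Concentrated a η L ε} ≤ _ := measure_mono hss
    _ ≤ ∑' p : A × M, ∑' k : ℕ, _ :=
        (measure_iUnion_le _).trans (ENNReal.tsum_le_tsum fun p => measure_iUnion_le _)
    _ ≤ ∑' p : A × M, ∑' k : ℕ,
          ENNReal.ofReal (2 * Real.exp (-(32 / 25) * L) * Real.exp (-η ^ 2 / 2) ^ k) :=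
        ENNReal.tsum_le_tsum fun p => ENNReal.tsum_le_tsum fun k => hterm p k
    _ = _ := by
        rw [← ENNReal.ofReal_tsum_of_nonneg (fun k => by positivity) (hsum.mul_left _),
          tsum_fintype, Finset.sum_const, Finset.card_univ, nsmul_eq_mul, tsum_mul_left,
          ← ENNReal.ofReal_natCast, ← ENNReal.ofReal_mul (by positivity)]
        congr 1
        ring

/-- The number of confidence levels `log n` at which the noise is not concentrated. -/
noncomputable def concentrationFailures (a : A → M → ℕ) (η : ℝ) (ε : A × M × ℕ → ℝ) : ℝ≥0∞ :=
  ∑' n : ℕ, {ε | ¬ Concentrated a η (Real.log n) ε}.indicator (fun _ => 1) ε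

lemma measurable_concentrationFailures [Countable A] [Countable M] (a : A → M → ℕ) (η : ℝ) :
    Measurable (concentrationFailures a η) :=
  Measurable.tsum fun n =>
    measurable_const.indicator (measurableSet_concentrated a η (Real.log n)).compl

lemma lintegral_concentrationFailures_lt_top [Fintype A] [Fintype M] (ν : Measure ℝ)
    [IsProbabilityMeasure ν] (hν : HasSubgaussianMGF (fun e : ℝ => e) 1 ν) (a : A → M → ℕ) {η : ℝ}
    (hη : 0 < η) :
    ∫⁻ ε, concentrationFailures a η ε ∂(Measure.infinitePi fun _ : A × M × ℕ => ν) < ⊤ := by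
  have hm : ∀ n : ℕ, MeasurableSet {ε | ¬ Concentrated a η (Real.log n) ε} := fun n =>
    (measurableSet_concentrated a η (Real.log n)).compl
  simp only [concentrationFailures]
  rw [lintegral_tsum fun n => (measurable_const.indicator (hm n)).aemeasurable]
  simp only [lintegral_indicator_const (hm _), one_mul]
  refine (ENNReal.tsum_le_tsum fun n : ℕ =>
    measure_not_concentrated_le ν hν a hη (Real.log_natCast_nonneg n)).trans_lt ?_
  rw [lt_top_iff_ne_top]
  refine Summable.tsum_ofReal_ne_top (Summable.mul_left _ ?_)
  rw [← summable_nat_add_iff 1]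
  -- At `L = log n` the bound is a constant times `n ^ (-32/25)`. This is why the threshold uses
  -- `4/5`: any factor above `1 / √2` gives an exponent beyond `1`, and one below `1` leaves room
  -- for the other errors.
  refine ((summable_nat_add_iff 1).2
    (Real.summable_nat_rpow (p := -(32 / 25)).2 (by norm_num))).congr fun n => ?_
  rw [Real.rpow_def_of_pos (by positivity), mul_comm]

/-- Concentration is monotone in the level, so the first good level starts an unbroken run of good
ones, and all positive levels before it are counted as failures. The burn-in time is thus dominated
by an integrable variable. -/
lemma exists_forall_concentrated {a : A → M → ℕ} {η : ℝ} {ε : A × M × ℕ → ℝ}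
    (h : concentrationFailures a η ε ≠ ⊤) :
    ∃ z : ℕ, (z : ℝ≥0∞) ≤ concentrationFailures a η ε + 1 ∧
      ∀ n, z ≤ n → Concentrated a η (Real.log n) ε := by
  have hex : ∃ n : ℕ, 1 ≤ n ∧ Concentrated a η (Real.log n) ε := by
    by_contra! hcon
    refine h (top_le_iff.1 ?_)
    calc (⊤ : ℝ≥0∞) = ∑' n : ℕ, 1 := (ENNReal.tsum_const_eq_top_of_ne_zero one_ne_zero).symm
      _ ≤ ∑' n : ℕ, {ε | ¬ Concentrated a η (Real.log (n + 1 : ℕ)) ε}.indicator (fun _ => 1) ε := by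
          refine ENNReal.tsum_le_tsum fun n => ?_
          rw [Set.indicator_of_mem (hcon (n + 1) (by omega))]
      _ ≤ _ := ENNReal.tsum_comp_le_tsum_of_injective (add_left_injective 1)
          (fun n : ℕ => {ε | ¬ Concentrated a η (Real.log n) ε}.indicator (fun _ => 1) ε)
  classical
  obtain ⟨h1, h2⟩ := Nat.find_spec hex
  refine ⟨Nat.find hex, ?_, fun n hn => h2.mono (Real.log_le_log (by exact_mod_cast h1)
    (by exact_mod_cast hn))⟩
  have hcard : ((Nat.find hex - 1 : ℕ) : ℝ≥0∞) ≤ concentrationFailures a η ε := by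
    calc ((Nat.find hex - 1 : ℕ) : ℝ≥0∞) = ∑ n ∈ Finset.Ico 1 (Nat.find hex), 1 := by simp
      _ ≤ ∑ n ∈ Finset.Ico 1 (Nat.find hex),
          {ε | ¬ Concentrated a η (Real.log n) ε}.indicator (fun _ => 1) ε := by
          refine Finset.sum_le_sum fun n hn => ?_
          rw [Finset.mem_Ico] at hn
          have := Nat.find_min hex hn.2
          rw [Set.indicator_of_mem]
          exact fun hc => this ⟨hn.1, hc⟩
      _ ≤ _ := ENNReal.sum_le_tsum _
  calc ((Nat.find hex : ℕ) : ℝ≥0∞) = ((Nat.find hex - 1 : ℕ) : ℝ≥0∞) + 1 := by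
        rw [← Nat.cast_add_one, Nat.sub_add_cancel h1]
    _ ≤ _ := by gcongr

end Noise

/-! ### The Lambert function -/

/-- The function `u * exp u` tends to `0` from below at `-∞`, so it exceeds `z` far to the left, and
the intermediate value theorem gives a root to the left of `w`. -/
lemma lambertWm1_le {z w : ℝ} (hz : z < 0) (hw : w ≤ -1) (hwz : w * Real.exp w ≤ z) :
    lambertWm1 z ≤ w := by
  have hbdd : BddBelow {w : ℝ | w ≤ -1 ∧ w * Real.exp w = z} := by
    -- A root satisfies `z * exp (-u) = u`, and `exp (-u) ≥ u ^ 2 / 2` then gives `u ≥ 2 / z`.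
    refine ⟨2 / z, fun u ⟨hu, huz⟩ => ?_⟩
    have h1 := Real.quadratic_le_exp_of_nonneg (x := -u) (by linarith)
    have h2 : z * Real.exp (-u) = u := by
      rw [← huz, mul_assoc, ← Real.exp_add]; simp
    rw [div_le_iff_of_neg hz]
    nlinarith
  have hlim : Tendsto (fun y : ℝ => -y * Real.exp (-y)) atTop (nhds 0) := by
    have := (Real.tendsto_pow_mul_exp_neg_atTop_nhds_zero 1).neg
    simpa using this
  obtain ⟨y, hy, hyw⟩ := ((hlim.eventually (lt_mem_nhds hz)).and
    (eventually_ge_atTop (-w))).exists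
  have hcont : ContinuousOn (fun u : ℝ => u * Real.exp u) (Set.Icc (-y) w) := by fun_prop
  obtain ⟨u, hu, huz⟩ := intermediate_value_Icc' (by linarith) hcont ⟨hwz, hy.le⟩
  exact (csInf_le hbdd ⟨hu.2.trans hw, huz⟩).trans hu.2

/-- This is all that is needed of the Lambert function. The test point is `w = -(C * log x / B)`:
the factor `exp w` matches the power of `x` in the argument, leaving a comparison of `log x` with
the constant `d ^ (C / B) / C`. -/
lemma eventually_log_le_qFun {d : ℕ} (hd : 0 < d) {B C : ℝ} (hB : 0 < B) (hC : 0 < C) :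
    ∀ᶠ x : ℝ in atTop, C * Real.log x ≤ qFun d B C x := by
  have hlog := Real.tendsto_log_atTop
  filter_upwards [eventually_gt_atTop 0, hlog.eventually_ge_atTop (B / C),
    hlog.eventually_ge_atTop ((d : ℝ) ^ (C / B) / C)] with x hx h1 h2
  have hd' : (0 : ℝ) < d := by exact_mod_cast hd
  rw [div_le_iff₀ hC] at h1 h2
  have hpow : (x / d) ^ (-(C / B)) = (d : ℝ) ^ (C / B) * Real.exp (-(C * Real.log x / B)) := by
    rw [Real.div_rpow hx.le hd'.le, Real.rpow_neg hd'.le, div_inv_eq_mul,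
      Real.rpow_def_of_pos hx, mul_comm]
    congr 2
    ring
  have hpos : 0 < (x / d) ^ (-(C / B)) := by positivity
  have hW := lambertWm1_le (z := -(1 / B) * (x / d) ^ (-(C / B))) (w := -(C * Real.log x / B))
    (by have := mul_pos (one_div_pos.2 hB) hpos; linarith)
    (by rw [neg_le_neg_iff, le_div_iff₀ hB]; linarith) (by
      rw [hpow, neg_mul, neg_mul, neg_le_neg_iff, ← mul_assoc]
      gcongr
      rw [div_mul_eq_mul_div, one_mul]
      gcongr
      linarith)
  calc C * Real.log x = -B * -(C * Real.log x / B) := by field_simp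
    _ ≤ qFun d B C x := by
      rw [qFun]
      exact mul_le_mul_of_nonpos_left hW (by linarith)

/-! ### Counting arrivals -/

lemma log_le_of_lt_two_pow {n r : ℕ} (hn : 0 < n) (hr : n < 2 ^ (r + 1)) :
    Real.log n ≤ (r + 1) * Real.log 2 := by
  calc Real.log n ≤ Real.log ((2 ^ (r + 1) : ℕ) : ℝ) :=
        Real.log_le_log (by positivity) (by exact_mod_cast hr.le)
    _ = (r + 1) * Real.log 2 := by push_cast; rw [Real.log_pow]; push_cast; ring

section Arrivals

variable {A : Type}

lemma ArrivalPath.Regular.finite_arrivals {x : ArrivalPath A} (hx : x.Regular) (j : A) (t : ℝ) :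
    {l | (x l).1 = j ∧ (x l).2 ≤ t}.Finite := by
  obtain ⟨N, hN⟩ := (hx.2.2.1.eventually_gt_atTop t).exists_forall_of_atTop
  refine (Set.finite_lt_nat N).subset fun l hl => ?_
  by_contra h
  exact absurd hl.2 (not_le.2 (hN l (not_lt.1 h)))

lemma ArrivalPath.Regular.arrivals_lt {x : ArrivalPath A} (hx : x.Regular) {i : A} {v : ℕ}
    (hv : 1 ≤ v) {t : ℝ} (ht : t < arrivalTime i v x) : arrivals i t x < v := by
  classical
  have hinf := hx.2.2.2 i
  have hsub : {l | (x l).1 = i ∧ (x l).2 ≤ t} ⊆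
      (Finset.range (Nat.nth (fun l => (x l).1 = i) (v - 1))).filter fun l => (x l).1 = i := by
    rintro l ⟨hl, hlt⟩
    rw [Finset.mem_coe, Finset.mem_filter, Finset.mem_range]
    refine ⟨?_, hl⟩
    by_contra h
    exact absurd (ht.trans_le (hx.2.1.monotone (not_lt.1 h))) (not_lt.2 hlt)
  have := Set.ncard_le_ncard hsub (Finset.finite_toSet _)
  rw [Set.ncard_coe_finset, ← Nat.count_eq_card_filter_range, Nat.count_nth_of_infinite hinf] at this
  rw [arrivals]
  omega

lemma ArrivalPath.Regular.le_arrivals {x : ArrivalPath A} (hx : x.Regular) {j : A} {n : ℕ}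
    {t : ℝ} (ht : arrivalTime j n x ≤ t) : n ≤ arrivals j t x := by
  classical
  rcases Nat.eq_zero_or_pos n with rfl | hn
  · exact Nat.zero_le _
  have hinf := hx.2.2.2 j
  have hsub : (((Finset.range (Nat.nth (fun l => (x l).1 = j) (n - 1) + 1)).filter
      fun l => (x l).1 = j : Finset ℕ) : Set ℕ) ⊆ {l | (x l).1 = j ∧ (x l).2 ≤ t} := by
    intro l hl
    rw [Finset.mem_coe, Finset.mem_filter, Finset.mem_range, Nat.lt_succ_iff] at hl
    exact ⟨hl.2, (hx.2.1.monotone hl.1).trans ht⟩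
  have := Set.ncard_le_ncard hsub (hx.finite_arrivals j t)
  rw [Set.ncard_coe_finset, ← Nat.count_eq_card_filter_range,
    Nat.count_nth_succ_of_infinite hinf] at this
  rw [arrivals]
  omega

lemma aemeasurable_arrivalTime [MeasurableSpace A] [DiscreteMeasurableSpace A]
    {P : Measure (ArrivalPath A)} (hP : ∀ᵐ x ∂P, ArrivalPath.Regular x) (j : A) (n : ℕ) :
    AEMeasurable (arrivalTime j n) P := by
  classical
  have hu : ∀ l, MeasurableSet {x : ArrivalPath A | (x l).1 = j} := fun l =>
    (measurable_fst.comp (measurable_pi_apply l)) (MeasurableSet.of_discrete (s := {j}))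
  have hcount : ∀ l, Measurable fun x : ArrivalPath A => Nat.count (fun t => (x t).1 = j) l := by
    intro l
    induction l with
    | zero => simp
    | succ l ih =>
      simp only [Nat.count_succ]
      exact ih.add (Measurable.ite (hu l) measurable_const measurable_const)
  have hmem : ∀ l, MeasurableSet {x : ArrivalPath A |
      (x l).1 = j ∧ Nat.count (fun t => (x t).1 = j) l = n - 1} := fun l =>
    (hu l).inter (hcount l (measurableSet_singleton (n - 1)))
  -- A measurable version of the arrival time: at most one index is an arrival of `j` preceded by
  -- exactly `n - 1` others, so the sum has a single term on regular paths.
  let g : ArrivalPath A → ℝ := fun x => ∑' l, {x : ArrivalPath A |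
      (x l).1 = j ∧ Nat.count (fun t => (x t).1 = j) l = n - 1}.indicator (fun x => (x l).2) x
  refine ⟨g, Measurable.tsum fun l =>
    (measurable_snd.comp (measurable_pi_apply l)).indicator (hmem l), ?_⟩
  · filter_upwards [hP] with x hx
    have hinf := hx.2.2.2 j
    have h1 : (x (Nat.nth (fun l => (x l).1 = j) (n - 1))).1 = j := Nat.nth_mem_of_infinite hinf _
    have h2 := Nat.count_nth_of_infinite hinf (n - 1)
    change _ = ∑' l, _
    rw [tsum_eq_single (Nat.nth (fun l => (x l).1 = j) (n - 1))]
    · rw [Set.indicator_of_mem (Set.mem_ofPred_eq ▸ ⟨h1, h2⟩)]; rfl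
    · intro l hl
      refine Set.indicator_of_notMem (fun h => hl ?_) _
      rw [← h.2, Nat.nth_count h.1]

/-- Write the square as a double integral of `a t * a t'` and drop the factor at the earlier time.
The two orderings of `t` and `t'` contribute equally. -/
lemma sq_lintegral_le {F : Measure ℝ} [IsProbabilityMeasure F] {a : ℝ → ℝ≥0∞} (ha : Measurable a)
    (ha1 : ∀ t, a t ≤ 1) : (∫⁻ t, a t ∂F) ^ 2 ≤ 2 * ∫⁻ t, a t * F (Set.Iic t) ∂F := by
  have hset : MeasurableSet {p : ℝ × ℝ | p.2 ≤ p.1} := measurableSet_le measurable_snd measurable_fst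
  have hf : Measurable (Function.uncurry fun t t' : ℝ => (Set.Iic t).indicator (fun _ => a t) t') := by
    have : (Function.uncurry fun t t' : ℝ => (Set.Iic t).indicator (fun _ => a t) t') =
        {p : ℝ × ℝ | p.2 ≤ p.1}.indicator fun p => a p.1 := by
      ext p; simp [Function.uncurry, Set.indicator]
    rw [this]
    exact (ha.comp measurable_fst).indicator hset
  have hI : ∫⁻ t, ∫⁻ t', (Set.Iic t).indicator (fun _ => a t) t' ∂F ∂F =
      ∫⁻ t, a t * F (Set.Iic t) ∂F :=
    lintegral_congr fun t => lintegral_indicator_const measurableSet_Iic _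
  calc (∫⁻ t, a t ∂F) ^ 2 = ∫⁻ t, ∫⁻ t', a t * a t' ∂F ∂F := by
        rw [sq, lintegral_lintegral_mul ha.aemeasurable ha.aemeasurable]
    _ ≤ ∫⁻ t, ∫⁻ t', ((Set.Iic t).indicator (fun _ => a t) t' +
          (Set.Iic t').indicator (fun _ => a t') t) ∂F ∂F := by
        refine lintegral_mono fun t => lintegral_mono fun t' => ?_
        rcases le_total t' t with h | h
        · rw [Set.indicator_of_mem (Set.mem_Iic.2 h)]
          exact (mul_le_of_le_one_right' (ha1 t')).trans le_self_add
        · rw [Set.indicator_of_mem (s := Set.Iic t') (Set.mem_Iic.2 h)]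
          exact (mul_le_of_le_one_left' (ha1 t)).trans le_add_self
    _ = ∫⁻ t, ∫⁻ t', (Set.Iic t).indicator (fun _ => a t) t' ∂F ∂F +
          ∫⁻ t, ∫⁻ t', (Set.Iic t').indicator (fun _ => a t') t ∂F ∂F := by
        rw [← lintegral_add_left (Measurable.lintegral_prod_right hf)]
        exact lintegral_congr fun t => lintegral_add_left (hf.comp (measurable_prodMk_left)) _
    _ = 2 * ∫⁻ t, a t * F (Set.Iic t) ∂F := by
        rw [lintegral_lintegral_swap (f := fun t t' => (Set.Iic t').indicator (fun _ => a t') t)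
          (hf.comp measurable_swap).aemeasurable, hI, two_mul]

/-- If two independent random variables are compared at an independent copy of one of them, then the
probability that they are in the wrong order is controlled. -/
lemma sq_measure_lt_le {Ω : Type*} [MeasurableSpace Ω] {P : Measure Ω} [IsProbabilityMeasure P]
    {U V : Ω → ℝ} (hU : AEMeasurable U P) (hV : AEMeasurable V P) (hUV : IndepFun U V P) :
    P {x | V x < U x} ^ 2 ≤ 2 * ∫⁻ t, P {x | t < U x ∧ V x ≤ t} ∂(P.map V) := by
  have := Measure.isProbabilityMeasure_map hU
  have := Measure.isProbabilityMeasure_map hV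
  have hset : MeasurableSet {p : ℝ × ℝ | p.2 < p.1} := measurableSet_lt measurable_snd measurable_fst
  have ha : Measurable fun t : ℝ => P.map U (Set.Ioi t) :=
    measurable_measure_prodMk_right hset
  have h1 : P {x | V x < U x} = ∫⁻ t, P.map U (Set.Ioi t) ∂(P.map V) := by
    calc P {x | V x < U x} = P.map (fun x => (U x, V x)) {p | p.2 < p.1} :=
          (Measure.map_apply_of_aemeasurable (hU.prodMk hV) hset).symm
      _ = _ := by
          rw [hUV.map_prod_eq_prod_map_map hU hV, Measure.prod_apply_symm hset]
          rfl
  rw [h1]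
  refine (sq_lintegral_le ha fun t => prob_le_one).trans_eq ?_
  congr 1
  refine lintegral_congr fun t => ?_
  rw [Measure.map_apply_of_aemeasurable hU measurableSet_Ioi,
    Measure.map_apply_of_aemeasurable hV measurableSet_Iic]
  exact (hUV.measure_inter_preimage_eq_mul _ _ measurableSet_Ioi measurableSet_Iic).symm

/-- The arrival paths on which the `2 ^ r`-th arrival of `j` precedes the arrival of `i` that brings
the number of arrivals of `i` to `(19 / 20) * C * log (2 ^ (r + 1))`. -/
def lateArrivals (C : ℝ) (i j : A) (r : ℕ) : Set (ArrivalPath A) :=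
  {x | arrivalTime j (2 ^ r) x < arrivalTime i ⌈19 / 20 * C * ((r + 1) * Real.log 2)⌉₊ x}

lemma ArrivalPath.Regular.mem_lateArrivals [DecidableEq A] {x : ArrivalPath A} (hx : x.Regular)
    {i j : A} (hij : i ≠ j) {C : ℝ} (hC : 0 ≤ C) {l r : ℕ} (hl : (x l).1 = j)
    (hr : 2 ^ r ≤ Nat.count (fun t => (x t).1 = j) l + 1)
    (hr' : Nat.count (fun t => (x t).1 = j) l + 1 < 2 ^ (r + 1))
    (hlt : (Nat.count (fun t => (x t).1 = i) l : ℝ) <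
      19 / 20 * C * Real.log (Nat.count (fun t => (x t).1 = j) l + 1 : ℕ)) :
    x ∈ lateArrivals C i j r := by
  set v := ⌈19 / 20 * C * ((r + 1) * Real.log 2)⌉₊ with hv
  have hlog : Real.log (Nat.count (fun t => (x t).1 = j) l + 1 : ℕ) ≤ (r + 1) * Real.log 2 :=
    log_le_of_lt_two_pow (Nat.succ_pos _) hr'
  have hiv : Nat.count (fun t => (x t).1 = i) l < v := by
    have : (Nat.count (fun t => (x t).1 = i) l : ℝ) < v :=
      hlt.trans_le ((mul_le_mul_of_nonneg_left hlog (by positivity)).trans (Nat.le_ceil _))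
    exact_mod_cast this
  have hi := hx.2.2.2 i
  have hj := hx.2.2.2 j
  have h1 : Nat.nth (fun t => (x t).1 = j) (2 ^ r - 1) ≤ l := by
    rw [← Nat.nth_count (p := fun t => (x t).1 = j) hl]
    exact Nat.nth_monotone hj (by omega)
  have h2 : l ≤ Nat.nth (fun t => (x t).1 = i) (v - 1) :=
    (Nat.count_le_iff_le_nth hi).1 (by omega)
  have h3 : Nat.nth (fun t => (x t).1 = j) (2 ^ r - 1) ≠ Nat.nth (fun t => (x t).1 = i) (v - 1) := by
    intro h
    have hi' : (x (Nat.nth (fun t => (x t).1 = i) (v - 1))).1 = i := Nat.nth_mem_of_infinite hi _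
    have hj' : (x (Nat.nth (fun t => (x t).1 = j) (2 ^ r - 1))).1 = j :=
      Nat.nth_mem_of_infinite hj _
    rw [h, hi'] at hj'
    exact hij hj'
  exact hx.2.1 (lt_of_le_of_ne (h1.trans h2) h3)

variable {M : Type} [Fintype M] [DecidableEq M] {k k' d d' : ℕ}

lemma exists_eventually_integral_le {I : ℕ → ℝ≥0∞}
    (h : limsup (fun n : ℕ => I n / (1 / (n : ℝ≥0∞) ^ 2)) atTop < ⊤) :
    ∃ K : ℝ≥0, ∀ᶠ n in atTop, I n ≤ K / (n : ℝ≥0∞) ^ 2 := by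
  obtain ⟨K, hK, hK'⟩ := exists_between h
  lift K to ℝ≥0 using hK'.ne
  refine ⟨K, ?_⟩
  filter_upwards [eventually_lt_of_limsup_lt hK, eventually_ge_atTop 1] with n hn hn1
  have hn0 : (n : ℝ≥0∞) ≠ 0 := by exact_mod_cast (by omega : n ≠ 0)
  rw [one_div, div_eq_mul_inv, inv_inv] at hn
  rw [ENNReal.le_div_iff_mul_le (Or.inl (by positivity)) (Or.inl (by finiteness))]
  exact hn.le

/-- At an independent copy of the `2 ^ r`-th arrival time of `j`, lateness of `i` implies `N_i < q
(N_j)`, an event of integrated probability `O(4 ^ (-r))`. The square root leaves `O(2 ^ (-r))`,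
which absorbs the weight `r + 2`. -/
lemma tsum_measure_lateArrivals_ne_top [MeasurableSpace A] [DiscreteMeasurableSpace A]
    {env : Environment A M k k' d d'} {c : A → M → ℝ} {P : Measure (ArrivalPath A)}
    [IsProbabilityMeasure P] (hP : ∀ᵐ x ∂P, ArrivalPath.Regular x) (hind : IndependentArrivals P)
    (hd : 0 < d) {i j : A} {m : M} (hc : 0 < c j m) (hgap : 0 < env.gap j m)
    (hB : 0 < ∑ n ∈ Finset.univ.erase m, 16 / env.gap i n ^ 2) (hi : i ∈ comparable env c P j m) :
    ∑' r : ℕ, ((r : ℝ≥0∞) + 2) * P (lateArrivals (16 * c j m ^ 2 / env.gap j m ^ 2) i j r) ≠ ⊤ := by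
  set C := 16 * c j m ^ 2 / env.gap j m ^ 2 with hC
  have hC0 : 0 < C := by positivity
  obtain ⟨hij, hlim⟩ := hi
  obtain ⟨K, hK⟩ := exists_eventually_integral_le hlim
  obtain ⟨X, hX⟩ := (eventually_log_le_qFun hd hB hC0).exists_forall_of_atTop
  have hindep : ∀ v n, 1 ≤ v → 1 ≤ n → IndepFun (arrivalTime i v) (arrivalTime j n) P := by
    intro v n hv hn
    have := (hind.indepFun hij).comp (measurable_pi_apply (v - 1)) (measurable_pi_apply (n - 1))
    have h1 : v - 1 + 1 = v := by omega
    have h2 : n - 1 + 1 = n := by omega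
    simpa only [Function.comp_def, h1, h2] using this
  have hbound : ∀ᶠ r : ℕ in atTop,
      P.real (lateArrivals C i j r) ≤ √(2 * K) * (1 / 2) ^ r := by
    have hpow : Tendsto (fun r : ℕ => 2 ^ r) atTop atTop := tendsto_pow_atTop_atTop_of_one_lt one_lt_two
    -- For `r ≥ 19` one has `(19/20) * (r + 1) ≤ r`. So the margin `19/20` pays for replacing `2 ^
    -- r` by the end `2 ^ (r + 1)` of the dyadic block.
    filter_upwards [hpow.eventually hK, eventually_ge_atTop 19,
      (tendsto_natCast_atTop_atTop.comp hpow).eventually_ge_atTop X] with r hr hr19 hrX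
    have hl2 := Real.log_pos one_lt_two
    set v := ⌈19 / 20 * C * ((r + 1) * Real.log 2)⌉₊ with hv
    have hv1 : 1 ≤ v := Nat.one_le_ceil_iff.2 (by positivity)
    have hr19' : (19 : ℝ) ≤ r := by exact_mod_cast hr19
    have hvlt : (v : ℝ) - 1 < C * Real.log ((2 ^ r : ℕ) : ℝ) := by
      have h1 : (v : ℝ) < 19 / 20 * C * ((r + 1) * Real.log 2) + 1 :=
        Nat.ceil_lt_add_one (by positivity)
      have h2 : Real.log ((2 ^ r : ℕ) : ℝ) = r * Real.log 2 := by push_cast; rw [Real.log_pow]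
      have h3 : 0 < C * Real.log 2 := by positivity
      rw [h2]
      nlinarith
    have hsq := sq_measure_lt_le (aemeasurable_arrivalTime hP i v)
      (aemeasurable_arrivalTime hP j (2 ^ r)) (hindep v (2 ^ r) hv1 Nat.one_le_two_pow)
    have hle : ∫⁻ t, P {x | t < arrivalTime i v x ∧ arrivalTime j (2 ^ r) x ≤ t}
        ∂(P.map (arrivalTime j (2 ^ r))) ≤
        ∫⁻ t, P {x | (arrivals i t x : ℝ) < qijm env c i j m (arrivals j t x)}
          ∂(P.map (arrivalTime j (2 ^ r))) := by
      refine lintegral_mono fun t => measure_mono_ae ?_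
      filter_upwards [hP] with x hx hx'
      obtain ⟨h1, h2⟩ := hx'
      have h3 := hx.arrivals_lt hv1 h1
      have h4 := hx.le_arrivals h2
      have h4' : ((2 ^ r : ℕ) : ℝ) ≤ arrivals j t x := by exact_mod_cast h4
      have h5 : (arrivals i t x : ℝ) ≤ v - 1 := by
        rw [le_sub_iff_add_le]; exact_mod_cast h3
      change (arrivals i t x : ℝ) < qFun d _ C _
      calc (arrivals i t x : ℝ) ≤ v - 1 := h5
        _ < C * Real.log ((2 ^ r : ℕ) : ℝ) := hvlt
        _ ≤ C * Real.log (arrivals j t x) := by gcongr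
        _ ≤ _ := hX _ (hrX.trans h4')
    have h6 : P (lateArrivals C i j r) ^ 2 ≤ 2 * (K / ((2 ^ r : ℕ) : ℝ≥0∞) ^ 2) :=
      hsq.trans (by gcongr; exact hle.trans hr)
    have h7 : P.real (lateArrivals C i j r) ^ 2 ≤ 2 * K * ((1 / 2) ^ r) ^ 2 := by
      have := ENNReal.toReal_mono (by finiteness) h6
      simp only [ENNReal.toReal_pow, ENNReal.toReal_mul, ENNReal.toReal_div, ENNReal.toReal_natCast,
        ENNReal.coe_toReal, ENNReal.toReal_ofNat] at this
      refine this.trans_eq ?_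
      push_cast
      rw [one_div, inv_pow]
      field_simp
    rw [← Real.sqrt_sq (by positivity : (0 : ℝ) ≤ (1 / 2) ^ r), ← Real.sqrt_mul (by positivity)]
    exact Real.le_sqrt_of_sq_le h7
  have hsum : Summable fun r : ℕ => ((r : ℝ) + 2) * P.real (lateArrivals C i j r) := by
    have hs1 : Summable fun r : ℕ => ((r : ℝ) ^ 1 * (1 / 2) ^ r) :=
      summable_pow_mul_geometric_of_norm_lt_one 1 (by norm_num)
    have hs2 : Summable fun r : ℕ => ((1 / 2 : ℝ)) ^ r := summable_geometric_two
    refine Summable.of_norm_bounded_eventually_nat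
      ((hs1.add (hs2.mul_left 2)).mul_left √(2 * K)) ?_
    filter_upwards [hbound] with r hr
    rw [Real.norm_of_nonneg (by positivity)]
    calc ((r : ℝ) + 2) * P.real (lateArrivals C i j r)
        ≤ ((r : ℝ) + 2) * (√(2 * K) * (1 / 2) ^ r) := by gcongr
      _ = _ := by ring
  convert hsum.tsum_ofReal_ne_top using 4 with r
  rw [ENNReal.ofReal_mul (by positivity), ofReal_measureReal,
    ENNReal.ofReal_add (by positivity) (by norm_num), ENNReal.ofReal_natCast, ENNReal.ofReal_ofNat]

end Arrivals

/-! ### Accuracy of the upper confidence bounds -/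

/-- The mean of the list is close to `μ`, at confidence level `L`. -/
def Accurate (η L μ : ℝ) (l : List ℝ) : Prop :=
  l.length ≠ 0 → |listMean l - μ| ≤ 17 / 20 * √(4 * L / l.length) + η

/-- Here `N` and `S` come from the given history and `k`, `e` from later play. The old bias costs
`1/20` of a width, so `4/5` becomes `17/20`, still below `1`. -/
lemma accurate_of_sum {l : List ℝ} {N k : ℕ} {S μ e η L : ℝ} (hlen : l.length = N + k)
    (hsum : l.sum = S + k * μ + e) (hL : 0 ≤ L) (hη : 0 ≤ η)
    (he : |e| ≤ 4 / 5 * √(4 * k * L) + η * k) (hS : 20 * |S - N * μ| ≤ √(4 * L)) :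
    Accurate η L μ l := by
  intro hl
  set n : ℝ := (l.length : ℝ) with hn
  have hn1 : 1 ≤ n := by rw [hn]; exact_mod_cast Nat.one_le_iff_ne_zero.2 hl
  have hn0 : 0 < n := by linarith
  have hnk : n = N + k := by rw [hn, hlen]; push_cast; ring
  have hkn : (k : ℝ) ≤ n := by rw [hnk]; linarith [(Nat.cast_nonneg N : (0 : ℝ) ≤ N)]
  have heq : listMean l - μ = ((S - N * μ) + e) / n := by
    rw [listMean, hsum, ← hn, eq_div_iff hn0.ne', sub_mul, div_mul_cancel₀ _ hn0.ne', hnk]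
    ring
  have hs1 : √(4 * L) ≤ √(4 * L / n) * n := by
    rw [Real.sqrt_div (by positivity), div_mul_eq_mul_div, le_div_iff₀ (by positivity)]
    gcongr
    exact Real.sqrt_le_iff.2 ⟨hn0.le, by nlinarith⟩
  have hs2 : √(4 * k * L) ≤ √(4 * L / n) * n := by
    refine Real.sqrt_le_iff.2 ⟨by positivity, ?_⟩
    rw [mul_pow, Real.sq_sqrt (by positivity)]
    have : 4 * L / n * n ^ 2 = 4 * n * L := by field_simp
    rw [this]
    gcongr
  rw [heq, abs_div, abs_of_pos hn0, div_le_iff₀ hn0]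
  have h1 := abs_add_le (S - N * μ) e
  have h2 : η * k ≤ η * n := by gcongr
  nlinarith

lemma abs_sum_mul_sub_le {ι : Type*} (E : Finset ι) (a Y μ : ι → ℝ) {r : ℝ}
    (h : ∀ i ∈ E, |Y i - μ i| ≤ r) :
    |∑ i ∈ E, a i * Y i - ∑ i ∈ E, a i * μ i| ≤ (∑ i ∈ E, |a i|) * r := by
  rw [← Finset.sum_sub_distrib, Finset.sum_mul]
  refine (Finset.abs_sum_le_sum_abs _ _).trans (Finset.sum_le_sum fun i hi => ?_)
  rw [← mul_sub, abs_mul]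
  gcongr
  exact h i hi

section Recommender

variable {A M : Type} [Fintype A] [DecidableEq A] [DecidableEq M] {k k' d d' : ℕ}
  {env : Environment A M k k' d d'} {Γ : Mechanism A M k} {c : A → M → ℝ}
  {o : A → Bool} {H : List (PubRecord A M)} {j : A} {m : M} {η L : ℝ}

lemma mean_eq_sum_coef (hpos : env.GeneralPosition) (hsco : Γ.SCOAssumption env) {E : Finset A}
    (hj : j ∉ E) (hE : E.card = d) (r : A → List ℝ) :
    env.mean j m = ∑ i ∈ E, Γ.coef env m j E r i * env.mean i m :=
  hsco m E j hj (hpos m E hE).ge r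

lemma notMem_others : j ∉ others o H j := by simp [others]

/-- The deviation of the synthetic estimate from the mean reward, if the selected users have reported
the arm at least `N` times. -/
lemma abs_synthetic_sub_mean_le (hpos : env.GeneralPosition) (hsco : Γ.SCOAssumption env)
    {E : Finset A} (hj : j ∉ E) (hE : E.card = d) (hL : 0 ≤ L)
    (hacc : ∀ i, Accurate η L (env.mean i m) (reports H i m)) {N : ℝ} (hN : 0 < N)
    (hle : ∀ i ∈ E, N ≤ cnt H i m) (r : A → List ℝ) :
    |∑ i ∈ E, Γ.coef env m j E r i * listMean (reports H i m) - env.mean j m| ≤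
      (∑ i ∈ E, |Γ.coef env m j E r i|) * (17 / 20 * √(4 * L / N) + η) := by
  rw [mean_eq_sum_coef hpos hsco hj hE r]
  refine abs_sum_mul_sub_le E _ _ _ fun i hi => ?_
  have hi' := hle i hi
  have h0 : (reports H i m).length ≠ 0 := by
    have : (0 : ℝ) < cnt H i m := hN.trans_le hi'
    have : 0 < cnt H i m := by exact_mod_cast this
    exact this.ne'
  refine (hacc i h0).trans ?_
  have : √(4 * L / ((reports H i m).length : ℝ)) ≤ √(4 * L / N) :=
    Real.sqrt_le_sqrt (div_le_div_of_nonneg_left (by positivity) hN hi')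
  gcongr

/-- The width in the index exceeds the random error of the synthetic estimate, so only the drift
`η`, amplified by the coefficients, can push the index below the mean. -/
lemma le_ucbcf (hpos : env.GeneralPosition) (hsco : Γ.SCOAssumption env)
    (hsel : Mechanism.ValidSelection d Γ) (hc : Γ.CoefBound env c) (hη : 0 ≤ η)
    (hL : L = Real.log (arrivalNo H j))
    (hacc : ∀ i, Accurate η L (env.mean i m) (reports H i m)) :
    ((env.mean j m - c j m * η : ℝ) : EReal) ≤ Γ.ucbcf env o H j m := by
  have hL0 : 0 ≤ L := hL ▸ Real.log_natCast_nonneg _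
  unfold Mechanism.ucbcf
  split_ifs with hd
  swap; · exact le_top
  obtain ⟨hsub, hcard, -⟩ := hsel o H j m hd
  extract_lets E a Nmin
  split_ifs with hN
  · exact le_top
  have hj : j ∉ E := fun hj => notMem_others (hsub hj)
  have hN0 : (0 : ℝ) < Nmin := by exact_mod_cast Nat.pos_of_ne_zero hN
  have hle : ∀ i ∈ E, (Nmin : ℝ) ≤ cnt H i m := fun i hi =>
    Nat.cast_le.2 (Nat.sInf_le (Set.mem_image_of_mem (fun i => cnt H i m) hi))
  have h1 := abs_synthetic_sub_mean_le hpos hsco hj hcard hL0 hacc hN0 hle (fun i => reports H i m)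
  have h2 := hc j m E hj hcard (fun i => reports H i m)
  have h3 : √(4 * L / Nmin) ≤ √((2 * Real.log d + 4 * Real.log (arrivalNo H j)) / Nmin) := by
    rw [hL]
    gcongr
    linarith [Real.log_natCast_nonneg d]
  rw [EReal.coe_le_coe_iff]
  have h4 : 0 ≤ ∑ i ∈ E, |a i| := Finset.sum_nonneg fun i _ => abs_nonneg _
  have h5 := (abs_le.1 h1).1
  change -((∑ i ∈ E, |a i|) * (17 / 20 * √(4 * L / Nmin) + η)) ≤ ∑ i ∈ E, a i * _ - _ at h5
  have h6 : (∑ i ∈ E, |a i|) * η ≤ c j m * η := by gcongr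
  have h7 := mul_le_mul_of_nonneg_left h3 h4
  have h8 : 0 ≤ (∑ i ∈ E, |a i|) * √(4 * L / Nmin) := by positivity
  linarith

lemma ucbcf_le (hpos : env.GeneralPosition) (hsco : Γ.SCOAssumption env)
    (hsel : Mechanism.ValidSelection d Γ) (hc : Γ.CoefBound env c) (hη : 0 ≤ η)
    (hL : L = Real.log (arrivalNo H j))
    (hacc : ∀ i, Accurate η L (env.mean i m) (reports H i m)) (hd0 : 0 < d)
    {D : Finset A} (hD : D ⊆ others o H j) (hDcard : D.card = d) {N : ℝ} (hN : 0 < N)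
    (hle : ∀ i ∈ D, N ≤ cnt H i m) :
    Γ.ucbcf env o H j m ≤ ((env.mean j m + c j m * (17 / 20 * √(4 * L / N) + η +
      √((2 * Real.log d + 4 * L) / N)) : ℝ) : EReal) := by
  have hL0 : 0 ≤ L := hL ▸ Real.log_natCast_nonneg _
  have hd : d ≤ (others o H j).card := hDcard ▸ Finset.card_le_card hD
  obtain ⟨hsub, hcard, hmax⟩ := hsel o H j m hd
  unfold Mechanism.ucbcf
  rw [if_pos hd]
  extract_lets E a Nmin
  -- The selection takes the largest counts, so it is at least as experienced as `D`: a selected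
  -- user outside `D` displaces some member of `D` with no larger count.
  have hleE : ∀ i ∈ E, N ≤ cnt H i m := by
    intro i hi
    by_cases hiD : i ∈ D
    · exact hle i hiD
    obtain ⟨i', hi'D, hi'E⟩ : ∃ i' ∈ D, i' ∉ E := by
      by_contra! hcon
      have : D = E := Finset.eq_of_subset_of_card_le hcon (by rw [hDcard, ← hcard])
      exact hiD (this ▸ hi)
    exact (hle i' hi'D).trans (by exact_mod_cast hmax i hi i' (hD hi'D) hi'E)
  have hj : j ∉ E := fun hj => notMem_others (hsub hj)
  have hEne : E.Nonempty := Finset.card_pos.1 (by rw [hcard]; exact hd0)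
  have hmem : Nmin ∈ (fun i => cnt H i m) '' (E : Set A) :=
    Nat.sInf_mem (Set.Nonempty.image _ hEne)
  have hNmin : N ≤ Nmin := by
    obtain ⟨i, hi, hi'⟩ := hmem
    rw [← hi']
    exact hleE i hi
  have hN0 : Nmin ≠ 0 := by
    have : (0 : ℝ) < Nmin := hN.trans_le hNmin
    exact_mod_cast this.ne'
  rw [if_neg hN0, EReal.coe_le_coe_iff]
  have h1 := abs_synthetic_sub_mean_le hpos hsco hj hcard hL0 hacc hN hleE (fun i => reports H i m)
  have h2 : ∑ i ∈ E, |a i| ≤ c j m := hc j m E hj hcard (fun i => reports H i m)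
  have h3 : √((2 * Real.log d + 4 * Real.log (arrivalNo H j)) / Nmin) ≤
      √((2 * Real.log d + 4 * L) / N) := by
    have := Real.log_natCast_nonneg d
    rw [← hL]
    gcongr
  have h4 : 0 ≤ ∑ i ∈ E, |a i| := Finset.sum_nonneg fun i _ => abs_nonneg _
  have h5 := (abs_le.1 h1).2
  change ∑ i ∈ E, a i * _ - _ ≤ (∑ i ∈ E, |a i|) * (17 / 20 * √(4 * L / N) + η) at h5
  have h6 : (∑ i ∈ E, |a i|) * (17 / 20 * √(4 * L / N) + η + √((2 * Real.log d + 4 * L) / N)) ≤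
      c j m * (17 / 20 * √(4 * L / N) + η + √((2 * Real.log d + 4 * L) / N)) := by gcongr
  have h7 := mul_le_mul_of_nonneg_left h3 h4
  linarith

variable {own : List (Record A M)}

lemma le_ucbse (hL : L = Real.log ((own.length + 1 : ℕ) : ℝ)) {μ : ℝ}
    (hacc : Accurate η L μ (ownRewards own m)) : ((μ - η : ℝ) : EReal) ≤ ucbse own m := by
  unfold ucbse
  extract_lets N
  split_ifs with hN
  · exact le_top
  have h1 := (abs_le.1 (hacc hN)).1
  have h2 := Real.sqrt_nonneg (4 * L / N)
  rw [EReal.coe_le_coe_iff, ← hL]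
  change -(17 / 20 * √(4 * L / N) + η) ≤ _ at h1
  linarith

lemma ucbse_le (hL : L = Real.log ((own.length + 1 : ℕ) : ℝ)) {μ : ℝ}
    (hacc : Accurate η L μ (ownRewards own m)) (hN : (ownRewards own m).length ≠ 0) :
    ucbse own m ≤ ((μ + η + 37 / 20 * √(4 * L / (ownRewards own m).length) : ℝ) : EReal) := by
  unfold ucbse
  extract_lets N
  rw [if_neg hN]
  have h1 := (abs_le.1 (hacc hN)).2
  rw [EReal.coe_le_coe_iff, ← hL]
  change _ ≤ 17 / 20 * √(4 * L / N) + η at h1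
  change _ ≤ μ + η + 37 / 20 * √(4 * L / N)
  linarith

lemma le_of_le_mul_sqrt_div {δ κ N : ℝ} (hδ : 0 ≤ δ) (hN : 0 < N) (hL : 0 ≤ L)
    (h : δ ≤ κ * √(4 * L / N)) : δ ^ 2 * N ≤ κ ^ 2 * (4 * L) := by
  have h1 : δ ^ 2 ≤ (κ * √(4 * L / N)) ^ 2 := by gcongr
  rw [mul_pow, Real.sq_sqrt (by positivity), mul_div_assoc', le_div_iff₀ hN] at h1
  exact h1

end Recommender

/-! ### The play of a complying profile -/

section Play

variable {A M : Type} [Fintype A] [DecidableEq A] [DecidableEq M] {k k' d d' : ℕ}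
  (env : Environment A M k k' d d') (Γ : Mechanism A M k)
  (s : A → Strategy A M) (o : A → Bool) (ε : A × M × ℕ → ℝ) (x : ArrivalPath A) (h : History A M)

/-- The record of the stage that is played when `n` stages have been played after history `h`. -/
noncomputable def recordAt (n : ℕ) : Record A M :=
  stage env Γ s o ε (play env Γ s o ε x h n) (x (h.length + n))

/-- The number of pulls of arm `m` by user `i` in the first `n` stages after history `h`. -/
noncomputable def pulls (i : A) (m : M) (n : ℕ) : ℕ :=
  Nat.count (fun t => (recordAt env Γ s o ε x h t).user = i ∧
    (recordAt env Γ s o ε x h t).arm = m) n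

/-- The sum of the first `n` noises of user `i` and arm `m` after history `h`. -/
noncomputable def noiseSum (i : A) (m : M) (n : ℕ) : ℝ :=
  ∑ t ∈ Finset.range n, ε (i, m, (ownRewards (ownRecords h i) m).length + t)

variable {env Γ s o ε x h} {i : A} {m : M} {n : ℕ}

lemma play_succ : play env Γ s o ε x h (n + 1) =
    recordAt env Γ s o ε x h n :: play env Γ s o ε x h n := rfl

lemma recordAt_user : (recordAt env Γ s o ε x h n).user = (x (h.length + n)).1 := rfl

lemma recordAt_reward : (recordAt env Γ s o ε x h n).reward =
    env.mean (recordAt env Γ s o ε x h n).user (recordAt env Γ s o ε x h n).arm +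
      ε ((recordAt env Γ s o ε x h n).user, (recordAt env Γ s o ε x h n).arm,
        (ownRewards (ownRecords (play env Γ s o ε x h n) (recordAt env Γ s o ε x h n).user)
          (recordAt env Γ s o ε x h n).arm).length) := rfl

lemma pulls_succ : pulls env Γ s o ε x h i m (n + 1) = pulls env Γ s o ε x h i m n +
    if (recordAt env Γ s o ε x h n).user = i ∧ (recordAt env Γ s o ε x h n).arm = m
      then 1 else 0 := Nat.count_succ _ _

lemma ownRecords_cons {r : Record A M} : ownRecords (r :: h) i =
    if r.user = i then r :: ownRecords h i else ownRecords h i := by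
  simp [ownRecords, List.filter_cons]

lemma ownRewards_cons {r : Record A M} : ownRewards (r :: h) m =
    if r.arm = m then r.reward :: ownRewards h m else ownRewards h m := by
  unfold ownRewards
  rw [List.filter_cons]
  by_cases hr : r.arm = m <;> simp [hr]

lemma reports_cons {r : Record A M} (hr : r.optIn = true) {H : List (PubRecord A M)} :
    reports (r.pub :: H) i m =
      if r.user = i ∧ r.report.1 = m then r.report.2 :: reports H i m else reports H i m := by
  unfold reports
  rw [List.filterMap_cons]
  by_cases h1 : r.user = i ∧ r.report.1 = m
  · simp [Record.pub, hr, h1]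
  · simp only [Record.pub, hr, if_true, if_neg h1]

/-- Rewards after `h` consume noises in order, starting at the number of pulls already made in `h`.
This determines the starting indices in `Concentrated`. -/
lemma ownRewards_play (i : A) (m : M) (n : ℕ) :
    (ownRewards (ownRecords (play env Γ s o ε x h n) i) m).length =
      (ownRewards (ownRecords h i) m).length + pulls env Γ s o ε x h i m n ∧
    (ownRewards (ownRecords (play env Γ s o ε x h n) i) m).sum =
      (ownRewards (ownRecords h i) m).sum + pulls env Γ s o ε x h i m n * env.mean i m +
        noiseSum ε h i m (pulls env Γ s o ε x h i m n) := by
  induction n with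
  | zero => simp [pulls, play, noiseSum]
  | succ n ih =>
    obtain ⟨ih1, ih2⟩ := ih
    rw [play_succ, ownRecords_cons, pulls_succ]
    by_cases hu : (recordAt env Γ s o ε x h n).user = i
    · rw [if_pos hu, ownRewards_cons]
      by_cases ha : (recordAt env Γ s o ε x h n).arm = m
      · rw [if_pos ha, if_pos ⟨hu, ha⟩, List.length_cons, List.sum_cons, ih2, recordAt_reward, hu, ha,
          ih1, noiseSum, noiseSum, Finset.sum_range_succ]
        refine ⟨by omega, ?_⟩
        push_cast
        ring
      · rw [if_neg ha, if_neg (fun hh => ha hh.2)]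
        exact ⟨ih1, ih2⟩
    · rw [if_neg hu, if_neg (fun hh => hu hh.1)]
      exact ⟨ih1, ih2⟩

/-! ### Opt-in status and reports under a complying profile -/

section Complying

variable (hs : ∀ i, (s i).Complies)
include hs

lemma recordAt_optIn : (recordAt env Γ s o ε x h n).optIn = true := (hs _).2.1 _ _ _

lemma recordAt_report : (recordAt env Γ s o ε x h n).report =
    ((recordAt env Γ s o ε x h n).arm, (recordAt env Γ s o ε x h n).reward) :=
  (hs _).2.2.2 _ _ _ _ _ _

lemma recordAt_signal : (recordAt env Γ s o ε x h n).signal =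
    some (Γ.ucbcf env o ((play env Γ s o ε x h n).map Record.pub)
      (recordAt env Γ s o ε x h n).user) :=
  if_pos (recordAt_optIn hs)

lemma min_ucb_le (m : M) :
    min (ucbse (ownRecords (play env Γ s o ε x h n) (recordAt env Γ s o ε x h n).user) m)
      (Γ.ucbcf env o ((play env Γ s o ε x h n).map Record.pub)
        (recordAt env Γ s o ε x h n).user m) ≤
    min (ucbse (ownRecords (play env Γ s o ε x h n) (recordAt env Γ s o ε x h n).user)
        (recordAt env Γ s o ε x h n).arm)
      (Γ.ucbcf env o ((play env Γ s o ε x h n).map Record.pub)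
        (recordAt env Γ s o ε x h n).user (recordAt env Γ s o ε x h n).arm) := by
  have h1 := (hs (recordAt env Γ s o ε x h n).user).2.2.1 (o (recordAt env Γ s o ε x h n).user)
    (ownRecords (play env Γ s o ε x h n) (recordAt env Γ s o ε x h n).user)
    (recordAt env Γ s o ε x h n).time (recordAt env Γ s o ε x h n).signal m
  change _ ≤ ucb _ _ (recordAt env Γ s o ε x h n).arm at h1
  rwa [recordAt_signal hs] at h1

/-- After `h` all reports are truthful, so reported rewards use the same noises as own rewards, even
if reports inside `h` were false or withheld. -/
lemma reports_play (i : A) (m : M) (n : ℕ) :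
    (reports ((play env Γ s o ε x h n).map Record.pub) i m).length =
      cnt (h.map Record.pub) i m + pulls env Γ s o ε x h i m n ∧
    (reports ((play env Γ s o ε x h n).map Record.pub) i m).sum =
      (reports (h.map Record.pub) i m).sum + pulls env Γ s o ε x h i m n * env.mean i m +
        noiseSum ε h i m (pulls env Γ s o ε x h i m n) := by
  induction n with
  | zero => simp [pulls, play, noiseSum, cnt]
  | succ n ih =>
    obtain ⟨ih1, ih2⟩ := ih
    rw [play_succ, List.map_cons, reports_cons (recordAt_optIn hs), pulls_succ, recordAt_report hs]
    by_cases hu : (recordAt env Γ s o ε x h n).user = i ∧ (recordAt env Γ s o ε x h n).arm = m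
    · rw [if_pos hu, if_pos hu, List.length_cons, List.sum_cons, ih2, recordAt_reward, hu.1, hu.2,
        (ownRewards_play i m n).1, noiseSum, noiseSum, Finset.sum_range_succ, ih1]
      refine ⟨by omega, ?_⟩
      push_cast
      ring
    · rw [if_neg hu, if_neg hu]
      exact ⟨ih1, ih2⟩

lemma optedIn_play {t : ℕ} (ht : t < n) (hi : (recordAt env Γ s o ε x h t).user = i) :
    optedIn o ((play env Γ s o ε x h n).map Record.pub) i = true := by
  induction n with
  | zero => omega
  | succ n ih =>
    rw [play_succ, List.map_cons]
    unfold optedIn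
    by_cases hu : (recordAt env Γ s o ε x h n).user = i
    · simp [Record.pub, hu, recordAt_optIn hs]
    · have htn : t < n := by
        rcases Nat.lt_succ_iff_lt_or_eq.1 ht with h1 | rfl
        · exact h1
        · exact absurd hi hu
      have := ih htn
      rw [List.find?_cons_of_neg (by simp [Record.pub, hu])]
      exact this

end Complying

/-- The history consists of stages at which the users of the first terms of the path arrived. -/
def MatchesPath (x : ArrivalPath A) (h : History A M) : Prop :=
  ∀ i, (ownRecords h i).length = Nat.count (fun t => (x t).1 = i) h.length

lemma length_ownRecords_play (hx : MatchesPath x h) (i : A) (n : ℕ) :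
    (ownRecords (play env Γ s o ε x h n) i).length =
      Nat.count (fun t => (x t).1 = i) (h.length + n) := by
  induction n with
  | zero => exact hx i
  | succ n ih =>
    rw [play_succ, ownRecords_cons, ← add_assoc, Nat.count_succ, recordAt_user]
    split_ifs <;> simp [ih]

lemma arrivalNo_pub (h : History A M) (i : A) :
    arrivalNo (h.map Record.pub) i = (ownRecords h i).length + 1 := by
  induction h with
  | nil => rfl
  | cons r h ih =>
    simp only [arrivalNo, ownRecords] at ih ⊢
    by_cases hr : r.user = i <;> simp_all [Record.pub]

lemma length_ownRecords_eq_sum [Fintype M] (i : A) (n : ℕ) :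
    (ownRecords (play env Γ s o ε x h n) i).length =
      (ownRecords h i).length + ∑ m, pulls env Γ s o ε x h i m n := by
  induction n with
  | zero => simp [pulls, play]
  | succ n ih =>
    simp only [pulls_succ, Finset.sum_add_distrib]
    rw [play_succ, ownRecords_cons]
    by_cases hu : (recordAt env Γ s o ε x h n).user = i
    · simp [hu, ih]; omega
    · simp [hu, ih]

/-- A bound of the deviations of the rewards and the reports in history `h` from the means. -/
noncomputable def bias [Fintype M] (env : Environment A M k k' d d') (h : History A M) : ℝ :=
  ∑ i, ∑ m, (|(ownRewards (ownRecords h i) m).sum -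
      (ownRewards (ownRecords h i) m).length * env.mean i m| +
    |(reports (h.map Record.pub) i m).sum - cnt (h.map Record.pub) i m * env.mean i m|)

variable [Fintype M]

lemma abs_add_abs_le_bias (i : A) (m : M) :
    |(ownRewards (ownRecords h i) m).sum -
      (ownRewards (ownRecords h i) m).length * env.mean i m| +
    |(reports (h.map Record.pub) i m).sum - cnt (h.map Record.pub) i m * env.mean i m| ≤
      bias env h := by
  let f : A → M → ℝ := fun i m => |(ownRewards (ownRecords h i) m).sum -
      (ownRewards (ownRecords h i) m).length * env.mean i m| +
    |(reports (h.map Record.pub) i m).sum - cnt (h.map Record.pub) i m * env.mean i m|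
  have hf : ∀ i m, 0 ≤ f i m := fun i m => by positivity
  calc f i m ≤ ∑ m, f i m := Finset.single_le_sum (fun m _ => hf i m) (Finset.mem_univ m)
    _ ≤ ∑ i, ∑ m, f i m := Finset.single_le_sum (f := fun i => ∑ m, f i m)
        (fun i _ => Finset.sum_nonneg fun m _ => hf i m) (Finset.mem_univ i)

variable {η L : ℝ}

lemma accurate_ownRewards (hη : 0 ≤ η) (hL : 0 ≤ L) (hbias : 20 * bias env h ≤ √(4 * L))
    (hcon : Concentrated (fun i m => (ownRewards (ownRecords h i) m).length) η L ε)
    (i : A) (m : M) (n : ℕ) :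
    Accurate η L (env.mean i m) (ownRewards (ownRecords (play env Γ s o ε x h n) i) m) := by
  obtain ⟨h1, h2⟩ := ownRewards_play (env := env) (Γ := Γ) (s := s) (o := o) (ε := ε) (x := x)
    (h := h) i m n
  refine accurate_of_sum h1 h2 hL hη (hcon i m _) (le_trans ?_ hbias)
  have := abs_add_abs_le_bias (env := env) (h := h) i m
  have := abs_nonneg ((reports (h.map Record.pub) i m).sum - cnt (h.map Record.pub) i m * env.mean i m)
  linarith

lemma accurate_reports (hs : ∀ i, (s i).Complies) (hη : 0 ≤ η) (hL : 0 ≤ L)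
    (hbias : 20 * bias env h ≤ √(4 * L))
    (hcon : Concentrated (fun i m => (ownRewards (ownRecords h i) m).length) η L ε)
    (i : A) (m : M) (n : ℕ) :
    Accurate η L (env.mean i m) (reports ((play env Γ s o ε x h n).map Record.pub) i m) := by
  obtain ⟨h1, h2⟩ := reports_play (env := env) (Γ := Γ) (o := o) (ε := ε) (x := x)
    (h := h) hs i m n
  refine accurate_of_sum h1 h2 hL hη (hcon i m _) (le_trans ?_ hbias)
  have := abs_add_abs_le_bias (env := env) (h := h) i m
  have := abs_nonneg ((ownRewards (ownRecords h i) m).sum -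
      (ownRewards (ownRecords h i) m).length * env.mean i m)
  linarith

end Play

/-! ### Counting the suboptimal pulls -/

/-- Consider the last time at which `p` holds: earlier occurrences number at most `V`, and that time
itself adds one. -/
lemma natCast_count_le_add_one {p q : ℕ → Prop} [DecidablePred p] [DecidablePred q] {V : ℝ}
    (hV : 0 ≤ V) (hpq : ∀ t, p t → q t) {n : ℕ} (h : ∀ t < n, p t → (Nat.count q t : ℝ) ≤ V) :
    (Nat.count p n : ℝ) ≤ V + 1 := by
  induction n with
  | zero => simp; linarith
  | succ n ih =>
    rw [Nat.count_succ]
    split_ifs with hp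
    · have h1 : Nat.count p n ≤ Nat.count q n := Nat.count_mono_left fun t _ => hpq t
      have h2 := h n (Nat.lt_succ_self n) hp
      have h3 : (Nat.count p n : ℝ) ≤ Nat.count q n := by exact_mod_cast h1
      push_cast
      linarith
    · simpa using ih fun t ht => h t (ht.trans (Nat.lt_succ_self n))

lemma tsum_ite_le_of_count_le {p : ℕ → Prop} [DecidablePred p] {V : ℝ}
    (h : ∀ n, (Nat.count p n : ℝ) ≤ V) :
    ∑' t, (if p t then 1 else 0 : ℝ≥0∞) ≤ ENNReal.ofReal V := by
  refine ENNReal.tsum_le_of_sum_range_le fun n => ?_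
  have : ∑ t ∈ Finset.range n, (if p t then 1 else 0 : ℝ≥0∞) = (Nat.count p n : ℝ≥0∞) := by
    rw [Nat.count_eq_card_filter_range, Finset.sum_boole]
  rw [this, ← ENNReal.ofReal_natCast]
  exact ENNReal.ofReal_le_ofReal (h n)

section Gap

variable {A M : Type} [Fintype M] {k k' d d' : ℕ} {env : Environment A M k k' d d'}

lemma Environment.mean_le_iSup (j : A) (m : M) : env.mean j m ≤ ⨆ n, env.mean j n :=
  le_ciSup (Set.finite_range _).bddAbove m

lemma gap_pos_of_mem_optimalFor {i : A} {m n : M} (hi : i ∈ optimalFor env m) (hn : n ≠ m) :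
    0 < env.gap i n :=
  sub_pos.2 ((hi n hn).trans_le (env.mean_le_iSup i m))

end Gap

section Play

variable {A M : Type} [Fintype A] [DecidableEq A] [Fintype M] [DecidableEq M] {k k' d d' : ℕ}
  {env : Environment A M k k' d d'} {Γ : Mechanism A M k} {c : A → M → ℝ}
  {s : A → Strategy A M} {o : A → Bool} {ε : A × M × ℕ → ℝ} {x : ArrivalPath A} {h : History A M}
  {η : ℝ}

/-- At an `n`-th arrival all reported and experienced means are accurate, in spite of history `h`. -/
def Reliable (env : Environment A M k k' d d') (h : History A M) (η : ℝ) (ε : A × M × ℕ → ℝ)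
    (n : ℕ) : Prop :=
  20 * bias env h ≤ √(4 * Real.log n) ∧ 25 * Real.log d ≤ Real.log n ∧
    Concentrated (fun i m => (ownRewards (ownRecords h i) m).length) η (Real.log n) ε

/-- The width `η` of the confidence intervals is negligible compared with the gaps. -/
def SmallWidth (env : Environment A M k k' d d') (c : A → M → ℝ) (η : ℝ) : Prop :=
  0 < η ∧ ∀ j m m', 0 < env.gap j m → η * (2 + c j m + c j m') ≤ env.gap j m / 100

/-- The standing assumptions on the mechanism and the profile. -/
structure Assumptions (env : Environment A M k k' d d') (Γ : Mechanism A M k) (c : A → M → ℝ)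
    (s : A → Strategy A M) : Prop where
  generalPosition : env.GeneralPosition
  sco : Γ.SCOAssumption env
  selection : Mechanism.ValidSelection d Γ
  coefPos : ∀ j m, 0 < c j m
  coefBound : Γ.CoefBound env c
  complies : ∀ i, (s i).Complies
  dim_pos : 0 < d

/-! ### Consequences of a single suboptimal pull -/

section Decision

variable (hA : Assumptions env Γ c s) (hη : SmallWidth env c η) {n : ℕ} {j : A} {m : M}
  (hj : (recordAt env Γ s o ε x h n).user = j) (hm : (recordAt env Γ s o ε x h n).arm = m)
  (hgap : 0 < env.gap j m)
  (hrel : Reliable env h η ε ((ownRecords (play env Γ s o ε x h n) j).length + 1))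

include hA hη hj hm hgap hrel

/-- The witness is an optimal arm. Both of its bounds are almost at least its mean, and the pulled
arm has the maximal index. -/
lemma exists_le_min_ucb : ∃ m',
    ((env.mean j m + env.gap j m - η * (1 + c j m') : ℝ) : EReal) ≤
      min (ucbse (ownRecords (play env Γ s o ε x h n) j) m)
        (Γ.ucbcf env o ((play env Γ s o ε x h n).map Record.pub) j m) := by
  have : Nonempty M := ⟨m⟩
  obtain ⟨m', hm'⟩ := exists_eq_ciSup_of_finite (f := fun m => env.mean j m)
  refine ⟨m', ?_⟩
  obtain ⟨h1, h2, h3⟩ := hrel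
  have hL := Real.log_natCast_nonneg ((ownRecords (play env Γ s o ε x h n) j).length + 1)
  have hle := min_ucb_le (env := env) (Γ := Γ) (o := o) (ε := ε) (x := x) (h := h) (n := n)
    hA.complies m'
  rw [hj, hm] at hle
  refine le_trans (le_min ?_ ?_) hle
  · refine le_trans ?_ (le_ucbse rfl (accurate_ownRewards hη.1.le hL h1 h3 j m' n))
    rw [EReal.coe_le_coe_iff, Environment.gap, ← hm']
    have := mul_pos hη.1 (hA.coefPos j m')
    linarith
  · refine le_trans ?_ (le_ucbcf (η := η) hA.generalPosition hA.sco hA.selection hA.coefBound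
      hη.1.le (by rw [arrivalNo_pub]) fun i => accurate_reports hA.complies hη.1.le hL h1 h3 i m' n)
    rw [EReal.coe_le_coe_iff, Environment.gap, ← hm']
    linarith [hη.1]

lemma ownRewards_length_le_of_pull :
    ((ownRewards (ownRecords (play env Γ s o ε x h n) j) m).length : ℝ) ≤
      16 / env.gap j m ^ 2 * Real.log ((ownRecords (play env Γ s o ε x h n) j).length + 1 : ℕ) := by
  obtain ⟨m', hm'⟩ := exists_le_min_ucb hA hη hj hm hgap hrel
  obtain ⟨h1, h2, h3⟩ := hrel
  set L := Real.log ((ownRecords (play env Γ s o ε x h n) j).length + 1 : ℕ)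
  have hL : 0 ≤ L := Real.log_natCast_nonneg _
  by_cases hN : (ownRewards (ownRecords (play env Γ s o ε x h n) j) m).length = 0
  · rw [hN, Nat.cast_zero]; positivity
  have hle := hm'.trans ((min_le_left _ _).trans
    (ucbse_le rfl (accurate_ownRewards hη.1.le hL h1 h3 j m n) hN))
  rw [EReal.coe_le_coe_iff] at hle
  set N := ((ownRewards (ownRecords (play env Γ s o ε x h n) j) m).length : ℝ) with hNdef
  have hN0 : 0 < N := by rw [hNdef]; exact_mod_cast Nat.pos_of_ne_zero hN
  have hw := hη.2 j m m' hgap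
  have hc := mul_pos hη.1 (hA.coefPos j m)
  have h4 : 99 / 100 * env.gap j m ≤ 37 / 20 * √(4 * L / N) := by linarith
  have h5 := le_of_le_mul_sqrt_div (by positivity) hN0 hL h4
  rw [div_mul_eq_mul_div, le_div_iff₀ (by positivity)]
  -- The constant: `4 * ((37/20) / (99/100)) ^ 2 < 16`.
  nlinarith

lemma le_of_pull {D : Finset A} (hDcard : D.card = d)
    (hD : D ⊆ others o ((play env Γ s o ε x h n).map Record.pub) j) {N : ℝ} (hN : 0 < N)
    (hle : ∀ i ∈ D, N ≤ cnt ((play env Γ s o ε x h n).map Record.pub) i m) :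
    N ≤ 9 / 10 * (16 * c j m ^ 2 / env.gap j m ^ 2) *
      Real.log ((ownRecords (play env Γ s o ε x h n) j).length + 1 : ℕ) := by
  obtain ⟨m', hm'⟩ := exists_le_min_ucb hA hη hj hm hgap hrel
  obtain ⟨h1, h2, h3⟩ := hrel
  set L := Real.log ((ownRecords (play env Γ s o ε x h n) j).length + 1 : ℕ)
  have hL : 0 ≤ L := Real.log_natCast_nonneg _
  have hub := hm'.trans ((min_le_right _ _).trans
    (ucbcf_le (L := L) (η := η) hA.generalPosition hA.sco hA.selection hA.coefBound hη.1.le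
      (by rw [arrivalNo_pub]) (fun i => accurate_reports hA.complies hη.1.le hL h1 h3 i m n)
      hA.dim_pos hD hDcard hN hle))
  rw [EReal.coe_le_coe_iff] at hub
  have hw := hη.2 j m m' hgap
  have hc := hA.coefPos j m
  -- From `25 * log d ≤ L`: `2 * log d + 4 * L ≤ 4.08 * L`, and `(101/100) ^ 2 * 4 = 4.0804`.
  have hs : √((2 * Real.log d + 4 * L) / N) ≤ 101 / 100 * √(4 * L / N) := by
    rw [Real.sqrt_le_left (by positivity), mul_pow, Real.sq_sqrt (by positivity), mul_div_assoc']
    gcongr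
    linarith
  have hs' := mul_le_mul_of_nonneg_left hs hc.le
  have h4 : 99 / 100 * env.gap j m ≤ 186 / 100 * c j m * √(4 * L / N) := by
    have := hη.1
    linarith
  have h5 := le_of_le_mul_sqrt_div (by positivity) hN hL h4
  have h6 : 9 / 10 * (16 * c j m ^ 2 / env.gap j m ^ 2) * L =
      (9 / 10 * 16 * c j m ^ 2 * L) / env.gap j m ^ 2 := by ring
  rw [h6, le_div_iff₀ (by positivity)]
  have h7 : 0 ≤ c j m ^ 2 * L := by positivity
  -- Here `186/100 = 17/20 + 101/100`, and `4 * (186/99) ^ 2 < 9/10 * 16`.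
  nlinarith

end Decision

lemma length_ownRecords_play_eq_add_count (i : A) (n : ℕ) :
    (ownRecords (play env Γ s o ε x h n) i).length =
      (ownRecords h i).length +
        Nat.count (fun t => (recordAt env Γ s o ε x h t).user = i) n := by
  induction n with
  | zero => rfl
  | succ n ih =>
    rw [play_succ, ownRecords_cons, Nat.count_succ]
    split_ifs <;> simp [ih]; omega

lemma count_early_le (i : A) (n₁ n : ℕ) :
    (Nat.count (fun t => (recordAt env Γ s o ε x h t).user = i ∧
      (ownRecords (play env Γ s o ε x h t) i).length + 1 < n₁) n : ℝ) ≤ n₁ + 1 := by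
  refine natCast_count_le_add_one (q := fun t => (recordAt env Γ s o ε x h t).user = i)
    (by positivity) (fun t ht => ht.1) fun t _ ht => ?_
  have h1 := length_ownRecords_play_eq_add_count (env := env) (Γ := Γ) (s := s) (o := o) (ε := ε)
    (x := x) (h := h) i t
  have h2 := ht.2
  exact_mod_cast (by omega :
    Nat.count (fun t => (recordAt env Γ s o ε x h t).user = i) t ≤ n₁)

lemma length_ownRecords_play_mono (i : A) :
    Monotone fun n => (ownRecords (play env Γ s o ε x h n) i).length := by
  refine monotone_nat_of_le_succ fun n => ?_
  rw [play_succ, ownRecords_cons]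
  split_ifs <;> simp

/-- Pulls before the burn-in arrival `n₁` are counted crudely. At any later pull, the
self-experience bound limits the pulls made so far. -/
lemma pulls_le_log (hA : Assumptions env Γ c s) (hη : SmallWidth env c η) {n₁ : ℕ}
    (hrel : ∀ n, n₁ ≤ n → Reliable env h η ε n) {i : A} {m : M} (hgap : 0 < env.gap i m) (n : ℕ) :
    (pulls env Γ s o ε x h i m n : ℝ) ≤ n₁ + 2 + 16 / env.gap i m ^ 2 *
      Real.log ((ownRecords (play env Γ s o ε x h n) i).length + 1 : ℕ) := by
  let q : ℕ → Prop := fun t => (recordAt env Γ s o ε x h t).user = i ∧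
    (recordAt env Γ s o ε x h t).arm = m
  let e : ℕ → Prop := fun t => (ownRecords (play env Γ s o ε x h t) i).length + 1 < n₁
  have hsplit : Nat.count q n ≤ Nat.count (fun t => (recordAt env Γ s o ε x h t).user = i ∧ e t) n +
      Nat.count (fun t => q t ∧ ¬ e t) n := by
    simp only [Nat.count_eq_card_filter_range]
    rw [← Finset.card_union_of_disjoint
      (Finset.disjoint_filter.2 fun t _ h1 h2 => h2.2 h1.2), ← Finset.filter_or]
    refine Finset.card_le_card (Finset.monotone_filter_right _ fun t _ ht => ?_)
    by_cases he : e t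
    · exact Or.inl ⟨ht.1, he⟩
    · exact Or.inr ⟨ht, he⟩
  have h1 := count_early_le (env := env) (Γ := Γ) (s := s) (o := o) (ε := ε) (x := x) (h := h) i n₁ n
  have h2 : (Nat.count (fun t => q t ∧ ¬ e t) n : ℝ) ≤ 16 / env.gap i m ^ 2 *
      Real.log ((ownRecords (play env Γ s o ε x h n) i).length + 1 : ℕ) + 1 := by
    refine natCast_count_le_add_one (q := q)
      (mul_nonneg (by positivity) (Real.log_natCast_nonneg _)) (fun t ht => ht.1)
      fun t ht hq => ?_
    have h3 := ownRewards_length_le_of_pull hA hη hq.1.1 hq.1.2 hgap (hrel _ (not_lt.1 hq.2))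
    have h4 : Nat.count q t ≤ (ownRewards (ownRecords (play env Γ s o ε x h t) i) m).length := by
      rw [(ownRewards_play i m t).1]; exact Nat.le_add_left _ _
    have h5 : (Nat.count q t : ℝ) ≤
      (ownRewards (ownRecords (play env Γ s o ε x h t) i) m).length := by exact_mod_cast h4
    refine h5.trans (h3.trans ?_)
    have := length_ownRecords_play_mono (env := env) (Γ := Γ) (s := s) (o := o) (ε := ε) (x := x)
      (h := h) i ht.le
    gcongr
  have h3 : (pulls env Γ s o ε x h i m n : ℝ) ≤
      Nat.count (fun t => (recordAt env Γ s o ε x h t).user = i ∧ e t) n +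
      Nat.count (fun t => q t ∧ ¬ e t) n := by exact_mod_cast hsplit
  refine h3.trans ?_
  change (Nat.count (fun t => (recordAt env Γ s o ε x h t).user = i ∧ e t) n : ℝ) ≤ _ at h1
  linarith

lemma length_ownRecords_le_cnt_add (hA : Assumptions env Γ c s) (hη : SmallWidth env c η) {n₁ : ℕ}
    (hrel : ∀ n, n₁ ≤ n → Reliable env h η ε n) {i : A} {m : M} (hi : i ∈ optimalFor env m) (n : ℕ) :
    ((ownRecords (play env Γ s o ε x h n) i).length : ℝ) ≤
      cnt ((play env Γ s o ε x h n).map Record.pub) i m +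
        (h.length + Fintype.card M * (n₁ + 2)) +
        (∑ m' ∈ Finset.univ.erase m, 16 / env.gap i m' ^ 2) *
          Real.log ((ownRecords (play env Γ s o ε x h n) i).length + 1 : ℕ) := by
  have h1 := length_ownRecords_eq_sum (env := env) (Γ := Γ) (s := s) (o := o) (ε := ε) (x := x)
    (h := h) i n
  have h2 : (pulls env Γ s o ε x h i m n : ℝ) ≤
      cnt ((play env Γ s o ε x h n).map Record.pub) i m := by
    have := (reports_play (env := env) (Γ := Γ) (o := o) (ε := ε) (x := x) (h := h)
      hA.complies i m n).1
    rw [cnt, this]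
    exact_mod_cast Nat.le_add_left _ _
  have h3 : ((ownRecords h i).length : ℝ) ≤ h.length := by
    exact_mod_cast List.length_filter_le _ _
  have h4 : ∑ m' ∈ Finset.univ.erase m, (pulls env Γ s o ε x h i m' n : ℝ) ≤
      ∑ m' ∈ Finset.univ.erase m, ((n₁ + 2 : ℝ) + 16 / env.gap i m' ^ 2 *
        Real.log ((ownRecords (play env Γ s o ε x h n) i).length + 1 : ℕ)) :=
    Finset.sum_le_sum fun m' hm' => pulls_le_log hA hη hrel
      (gap_pos_of_mem_optimalFor hi (Finset.ne_of_mem_erase hm')) n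
  rw [Finset.sum_add_distrib, ← Finset.sum_mul, Finset.sum_const, nsmul_eq_mul] at h4
  have h5 : ((Finset.univ.erase m).card : ℝ) * (n₁ + 2) ≤ Fintype.card M * (n₁ + 2) := by
    gcongr
    exact Finset.card_le_univ _
  rw [← Finset.add_sum_erase _ _ (Finset.mem_univ m)] at h1
  have h6 : ((ownRecords (play env Γ s o ε x h n) i).length : ℝ) = (ownRecords h i).length +
      (pulls env Γ s o ε x h i m n +
        ∑ m' ∈ Finset.univ.erase m, (pulls env Γ s o ε x h i m' n : ℝ)) := by
    rw [h1]; push_cast; ring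
  linarith

/-- A user whose optimal arm is `m` has reported this arm in most of her arrivals, unless she has
arrived rarely. -/
lemma le_of_cnt_le (hA : Assumptions env Γ c s) (hη : SmallWidth env c η) {n₁ : ℕ}
    (hrel : ∀ n, n₁ ≤ n → Reliable env h η ε n) {i : A} {m : M} (hi : i ∈ optimalFor env m)
    {B : ℝ} (hB : B = ∑ m' ∈ Finset.univ.erase m, 16 / env.gap i m' ^ 2) (hB0 : 0 < B)
    {C L : ℝ} (hC : 0 < C) {n : ℕ}
    (hlen : 19 / 20 * C * L ≤ (ownRecords (play env Γ s o ε x h n) i).length)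
    (hcnt : cnt ((play env Γ s o ε x h n).map Record.pub) i m ≤ 9 / 10 * C * L) :
    L ≤ 80 / C * (h.length + 1 + 2 * Fintype.card M + B * |Real.log (40 * B)|) * (1 + n₁) := by
  have h1 := length_ownRecords_le_cnt_add (o := o) (x := x) hA hη hrel hi n
  rw [← hB] at h1
  set a : ℝ := (((ownRecords (play env Γ s o ε x h n) i).length + 1 : ℕ) : ℝ) with ha
  have ha' : ((ownRecords (play env Γ s o ε x h n) i).length : ℝ) = a - 1 := by rw [ha]; simp
  have ha0 : 0 < a := by positivity
  rw [ha'] at h1 hlen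
  -- The fraction `1/40` is small enough that `(39/40) * (19/20) > 9/10`. Hence a positive multiple
  -- of `C * L` survives when `hcnt` is compared with `hlen`.
  have h2 : B * Real.log a ≤ a / 40 + B * |Real.log (40 * B)| := by
    have h3 : Real.log a = Real.log (a / (40 * B)) + Real.log (40 * B) := by
      rw [← Real.log_mul (by positivity) (by positivity), div_mul_cancel₀ _ (by positivity)]
    have h4 : Real.log (a / (40 * B)) ≤ a / (40 * B) :=
      (Real.log_le_sub_one_of_pos (by positivity)).trans (by linarith)
    calc B * Real.log a ≤ B * (a / (40 * B) + |Real.log (40 * B)|) := by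
          rw [h3]
          gcongr
          exact le_abs_self _
      _ = _ := by field_simp
  have h5 : 0 ≤ B * |Real.log (40 * B)| := by positivity
  have h6 : (0 : ℝ) ≤ Fintype.card M * n₁ := by positivity
  have h7 : (0 : ℝ) ≤ h.length * n₁ := by positivity
  have h8 : 0 ≤ B * |Real.log (40 * B)| * n₁ := by positivity
  have h9 : (0 : ℝ) ≤ n₁ := by positivity
  have h10 : (0 : ℝ) ≤ Fintype.card M := by positivity
  have h11 : (0 : ℝ) ≤ h.length := by positivity
  rw [div_mul_eq_mul_div, div_mul_eq_mul_div, le_div_iff₀ hC]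
  nlinarith

/-- When a suboptimal arm is pulled, then some user from whom it can be learned is late, or the number
of arrivals is bounded. -/
lemma late_or_log_le_of_pull (hA : Assumptions env Γ c s) (hη : SmallWidth env c η) {j : A} {m : M}
    (hgap : 0 < env.gap j m) {D : Finset A} (hDcard : D.card = d) (hjD : j ∉ D)
    (hD : ∀ i ∈ D, i ∈ optimalFor env m) {B : A → ℝ}
    (hB : ∀ i, B i = ∑ m' ∈ Finset.univ.erase m, 16 / env.gap i m' ^ 2) (hB0 : ∀ i ∈ D, 0 < B i)
    {C : ℝ} (hC : C = 16 * c j m ^ 2 / env.gap j m ^ 2) (hC0 : 0 < C) {K₀ : ℝ}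
    (hK₀ : ∀ i ∈ D,
      80 / C * (h.length + 1 + 2 * Fintype.card M + B i * |Real.log (40 * B i)|) ≤ K₀)
    {n₁ : ℕ} (hrel : ∀ n, n₁ ≤ n → Reliable env h η ε n)
    (hlong : ∀ n : ℕ, n₁ ≤ n → (h.length : ℝ) < 19 / 20 * C * Real.log n)
    (hx : x.Regular) (hmatch : MatchesPath x h) {t : ℕ}
    (hj : (recordAt env Γ s o ε x h t).user = j) (hm : (recordAt env Γ s o ε x h t).arm = m)
    (h1 : n₁ ≤ (ownRecords (play env Γ s o ε x h t) j).length + 1) :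
    (∃ i ∈ D, x ∈ lateArrivals C i j
      (Nat.log 2 ((ownRecords (play env Γ s o ε x h t) j).length + 1))) ∨
    Real.log ((ownRecords (play env Γ s o ε x h t) j).length + 1 : ℕ) ≤ K₀ * (1 + n₁) := by
  set L := Real.log ((ownRecords (play env Γ s o ε x h t) j).length + 1 : ℕ) with hL
  have hlong' := hlong _ h1
  rw [← hL] at hlong'
  have hCL : 0 < C * L := by
    have : (0 : ℝ) ≤ h.length := by positivity
    nlinarith
  by_cases h2 : ∃ i ∈ D, ((ownRecords (play env Γ s o ε x h t) i).length : ℝ) < 19 / 20 * C * L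
  · obtain ⟨i, hi, hlt⟩ := h2
    refine Or.inl ⟨i, hi, ?_⟩
    rw [hL] at hlt
    rw [length_ownRecords_play hmatch] at hlt ⊢
    rw [length_ownRecords_play hmatch] at hlt
    exact hx.mem_lateArrivals (l := h.length + t) (ne_of_mem_of_not_mem hi hjD) hC0.le hj
      (Nat.pow_log_le_self 2 (Nat.succ_ne_zero _)) (Nat.lt_pow_succ_log_self one_lt_two _) hlt
  right
  push Not at h2
  obtain ⟨i, hi, hmin⟩ := Finset.exists_min_image D
    (fun i => cnt ((play env Γ s o ε x h t).map Record.pub) i m)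
    (Finset.card_pos.1 (hDcard ▸ hA.dim_pos))
  -- Otherwise even the least experienced user of `D` has too many reports for `le_of_pull` to allow
  -- the pull.
  have hcnt : (cnt ((play env Γ s o ε x h t).map Record.pub) i m : ℝ) ≤ 9 / 10 * C * L := by
    by_contra! hgt
    have hle : (cnt ((play env Γ s o ε x h t).map Record.pub) i m : ℝ) ≤ 9 / 10 * C * L := by
      rw [hC]
      refine le_of_pull hA hη hj hm hgap (hrel _ h1) hDcard (fun i' hi' => ?_)
        (lt_of_le_of_lt (by linarith) hgt) fun i' hi' => Nat.cast_le.2 (hmin i' hi')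
      -- A user of `D` may have been opted out in `h`. Having more arrivals than `h` has stages, she
      -- has arrived since, and so has opted in.
      have hpos : Nat.count (fun t => (recordAt env Γ s o ε x h t).user = i') t ≠ 0 := by
        have e1 := length_ownRecords_play_eq_add_count (env := env) (Γ := Γ) (s := s) (o := o)
          (ε := ε) (x := x) (h := h) i' t
        have e2 : h.length < (ownRecords (play env Γ s o ε x h t) i').length := by
          exact_mod_cast hlong'.trans_le (h2 i' hi')
        have e3 : (ownRecords h i').length ≤ h.length := List.length_filter_le _ _
        omega
      obtain ⟨t', ht', hu⟩ := Nat.count_ne_iff_exists.1 hpos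
      rw [others, Finset.mem_filter]
      exact ⟨Finset.mem_univ _, ne_of_mem_of_not_mem hi' hjD, optedIn_play hA.complies ht' hu⟩
    exact absurd hle (not_le.2 hgt)
  refine (le_of_cnt_le hA hη hrel (hD i hi) (hB i) (hB0 i hi) hC0 (h2 i hi) hcnt).trans ?_
  gcongr
  exact hK₀ i hi

/-- The total number of pulls of a suboptimal arm is bounded in terms of the reliability of the noise
and of the late arrivals of the users from whom the arm can be learned. -/
lemma exists_tsum_pulls_le (hA : Assumptions env Γ c s) (hη : SmallWidth env c η) {j : A} {m : M}
    (hgap : 0 < env.gap j m) {D : Finset A} (hDcard : D.card = d) (hjD : j ∉ D)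
    (hD : ∀ i ∈ D, i ∈ optimalFor env m)
    (hB : ∀ i ∈ D, 0 < ∑ m' ∈ Finset.univ.erase m, 16 / env.gap i m' ^ 2)
    (o : A → Bool) (h : History A M) :
    ∃ K : ℝ≥0, ∀ (ε : A × M × ℕ → ℝ) (x : ArrivalPath A) (n₁ : ℕ),
      (∀ n, n₁ ≤ n → Reliable env h η ε n) →
      (∀ n : ℕ, n₁ ≤ n →
        (h.length : ℝ) < 19 / 20 * (16 * c j m ^ 2 / env.gap j m ^ 2) * Real.log n) →
      x.Regular → MatchesPath x h →
      ∑' t, (if (recordAt env Γ s o ε x h t).user = j ∧ (recordAt env Γ s o ε x h t).arm = m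
        then 1 else 0 : ℝ≥0∞) ≤ K * (1 + n₁) + K * ∑ i ∈ D, ∑' r : ℕ,
          (lateArrivals (16 * c j m ^ 2 / env.gap j m ^ 2) i j r).indicator
            (fun _ => (r : ℝ≥0∞) + 2) x := by
  classical
  set C := 16 * c j m ^ 2 / env.gap j m ^ 2 with hCdef
  have hC : 0 < C := by have := hA.coefPos j m; positivity
  obtain ⟨G, hG⟩ : ∃ G, G = 16 / env.gap j m ^ 2 := ⟨_, rfl⟩
  have hG0 : 0 < G := by rw [hG]; positivity
  let B : A → ℝ := fun i => ∑ m' ∈ Finset.univ.erase m, 16 / env.gap i m' ^ 2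
  obtain ⟨K₀, hK₀0, hK₀⟩ : ∃ K₀ : ℝ, 0 ≤ K₀ ∧ ∀ i ∈ D,
      80 / C * (h.length + 1 + 2 * Fintype.card M + B i * |Real.log (40 * B i)|) ≤ K₀ := by
    have hκ : ∀ i ∈ D,
        0 ≤ 80 / C * (h.length + 1 + 2 * Fintype.card M + B i * |Real.log (40 * B i)|) := by
      intro i hi
      have : 0 < B i := hB i hi
      positivity
    exact ⟨_, Finset.sum_nonneg hκ, fun i hi => Finset.single_le_sum hκ hi⟩
  -- The constant depends on the history but not on the noise, the path or the burn-in time, so that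
  -- expectations can be taken afterwards.
  let K : ℝ≥0 := (G * K₀ + G + 2).toNNReal
  have hK : (K : ℝ≥0∞) = ENNReal.ofReal (G * K₀ + G + 2) := rfl
  refine ⟨K, fun ε x n₁ hrel hlong hx hmatch => ?_⟩
  let ℓ : A → ℕ → ℕ := fun i t => (ownRecords (play env Γ s o ε x h t) i).length
  let q : ℕ → Prop := fun t => (recordAt env Γ s o ε x h t).user = j ∧
    (recordAt env Γ s o ε x h t).arm = m
  let p₁ : ℕ → Prop := fun t => (recordAt env Γ s o ε x h t).user = j ∧ ℓ j t + 1 < n₁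
  let p₂ : ℕ → Prop := fun t => q t ∧ n₁ ≤ ℓ j t + 1 ∧
    Real.log (ℓ j t + 1 : ℕ) ≤ K₀ * (1 + n₁)
  -- Pulls blamed on a late user in block `r`. There are at most `G * (r + 1) * log 2 + 1` of them,
  -- which is the source of the weight `r + 2`.
  let p₃ : ℕ → ℕ → Prop := fun r t => q t ∧ n₁ ≤ ℓ j t + 1 ∧ ℓ j t + 1 < 2 ^ (r + 1) ∧
    ∃ i ∈ D, x ∈ lateArrivals C i j r
  have hcases : ∀ t, q t → p₁ t ∨ p₂ t ∨ ∃ r, p₃ r t := by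
    intro t hq
    by_cases h1 : ℓ j t + 1 < n₁
    · exact Or.inl ⟨hq.1, h1⟩
    rw [not_lt] at h1
    rcases late_or_log_le_of_pull hA hη hgap hDcard hjD hD (fun _ => rfl) hB hCdef hC
      hK₀ hrel hlong hx hmatch hq.1 hq.2 h1 with h2 | h2
    · exact Or.inr (Or.inr ⟨_, hq, h1, Nat.lt_pow_succ_log_self one_lt_two _, h2⟩)
    · exact Or.inr (Or.inl ⟨hq, h1, h2⟩)
  have hpull : ∀ t, q t → n₁ ≤ ℓ j t + 1 → (Nat.count q t : ℝ) ≤ G * Real.log (ℓ j t + 1 : ℕ) := by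
    intro t hq h1
    rw [hG]
    refine le_trans ?_ (ownRewards_length_le_of_pull hA hη hq.1 hq.2 hgap (hrel _ h1))
    rw [(ownRewards_play j m t).1]
    exact_mod_cast Nat.le_add_left _ _
  have hb₁ : ∑' t, (if p₁ t then 1 else 0 : ℝ≥0∞) ≤ ENNReal.ofReal (n₁ + 1) :=
    tsum_ite_le_of_count_le fun n => count_early_le j n₁ n
  have hb₂ : ∑' t, (if p₂ t then 1 else 0 : ℝ≥0∞) ≤ ENNReal.ofReal (G * (K₀ * (1 + n₁)) + 1) :=
    tsum_ite_le_of_count_le fun n => natCast_count_le_add_one (q := q)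
      (mul_nonneg hG0.le (mul_nonneg hK₀0 (by positivity)))
      (fun t ht => ht.1) fun t _ ht => (hpull t ht.1 ht.2.1).trans
        (mul_le_mul_of_nonneg_left ht.2.2 hG0.le)
  have hb₃ : ∀ r, ∑' t, (if p₃ r t then 1 else 0 : ℝ≥0∞) ≤
      K * ∑ i ∈ D, (lateArrivals C i j r).indicator (fun _ => (r : ℝ≥0∞) + 2) x := by
    intro r
    by_cases hr : ∃ i ∈ D, x ∈ lateArrivals C i j r
    · obtain ⟨i, hi, hxi⟩ := hr
      have e1 : ∑' t, (if p₃ r t then 1 else 0 : ℝ≥0∞) ≤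
          ENNReal.ofReal (G * ((r + 1) * Real.log 2) + 1) := by
        have hl2 := Real.log_pos one_lt_two
        have hV : 0 ≤ G * ((r + 1) * Real.log 2) := by positivity
        refine tsum_ite_le_of_count_le fun n => natCast_count_le_add_one (q := q) hV
          (fun t ht => ht.1) fun t _ ht => (hpull t ht.1 ht.2.1).trans ?_
        refine mul_le_mul_of_nonneg_left ?_ hG0.le
        exact log_le_of_lt_two_pow (Nat.succ_pos _) ht.2.2.1
      refine e1.trans ?_
      calc ENNReal.ofReal (G * ((r + 1) * Real.log 2) + 1)
          ≤ ENNReal.ofReal ((G * K₀ + G + 2) * (r + 2)) := by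
            refine ENNReal.ofReal_le_ofReal ?_
            have hl2 : Real.log 2 ≤ 1 := by linarith [Real.log_two_lt_d9]
            have hr0 : (0 : ℝ) ≤ r := by positivity
            have e2 : (r + 1) * Real.log 2 ≤ r + 1 := mul_le_of_le_one_right (by positivity) hl2
            have e3 := mul_le_mul_of_nonneg_left e2 hG0.le
            have e4 : 0 ≤ G * K₀ * (r + 2) := by positivity
            nlinarith
        _ = K * ((r : ℝ≥0∞) + 2) := by
            rw [ENNReal.ofReal_mul (by positivity), ← hK,
              ENNReal.ofReal_add (by positivity) (by norm_num), ENNReal.ofReal_natCast,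
              ENNReal.ofReal_ofNat]
        _ ≤ _ := by
            gcongr
            calc (r : ℝ≥0∞) + 2 =
                  (lateArrivals C i j r).indicator (fun _ => (r : ℝ≥0∞) + 2) x := by
                  rw [Set.indicator_of_mem hxi]
              _ ≤ _ := Finset.single_le_sum
                  (f := fun i => (lateArrivals C i j r).indicator (fun _ => (r : ℝ≥0∞) + 2) x)
                  (fun _ _ => zero_le) hi
    · have : ∀ t, ¬ p₃ r t := fun t ht => hr ht.2.2.2
      simp [this]
  calc ∑' t, (if q t then 1 else 0 : ℝ≥0∞)
      ≤ ∑' t, ((if p₁ t then 1 else 0) + (if p₂ t then 1 else 0) +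
          ∑' r, (if p₃ r t then 1 else 0) : ℝ≥0∞) := by
        refine ENNReal.tsum_le_tsum fun t => ?_
        by_cases hq : q t
        · rw [if_pos hq]
          rcases hcases t hq with h1 | h2 | ⟨r, h3⟩
          · rw [if_pos h1, add_assoc]; exact le_self_add
          · rw [if_pos h2, add_right_comm]; exact le_add_self
          · refine le_trans ?_ le_add_self
            refine le_trans ?_ (ENNReal.le_tsum r)
            rw [if_pos h3]
        · rw [if_neg hq]; exact zero_le
    _ = ∑' t, (if p₁ t then 1 else 0 : ℝ≥0∞) + ∑' t, (if p₂ t then 1 else 0 : ℝ≥0∞) +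
          ∑' r, ∑' t, (if p₃ r t then 1 else 0 : ℝ≥0∞) := by
        rw [ENNReal.tsum_add, ENNReal.tsum_add, ENNReal.tsum_comm]
    _ ≤ ENNReal.ofReal (n₁ + 1) + ENNReal.ofReal (G * (K₀ * (1 + n₁)) + 1) +
          ∑' r : ℕ, K * ∑ i ∈ D, (lateArrivals C i j r).indicator (fun _ => (r : ℝ≥0∞) + 2) x := by
        gcongr
        exact hb₃ _
    _ ≤ _ := by
        rw [ENNReal.tsum_mul_left, Summable.tsum_finsetSum fun _ _ => ENNReal.summable]
        gcongr
        rw [← ENNReal.ofReal_add (by positivity) (by positivity), hK, ← ENNReal.ofReal_natCast,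
          ← ENNReal.ofReal_one, ← ENNReal.ofReal_add (by positivity) (by positivity),
          ← ENNReal.ofReal_mul (by positivity)]
        refine ENNReal.ofReal_le_ofReal ?_
        have : (0 : ℝ) ≤ n₁ := by positivity
        nlinarith [mul_nonneg hG0.le this]

end Play

/-! ### Bounded expected regret -/

section Regret

variable {A M : Type} [Fintype A] [DecidableEq A] [Fintype M] [DecidableEq M] {k k' d d' : ℕ}
  {env : Environment A M k k' d d'} {Γ : Mechanism A M k} {c : A → M → ℝ}
  {s : A → Strategy A M} {η : ℝ}

lemma exists_smallWidth (env : Environment A M k k' d d') (c : A → M → ℝ) :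
    ∃ η, SmallWidth env c η := by
  have h : ∀ᶠ η in nhdsWithin (0 : ℝ) (Set.Ioi 0), ∀ j m m', 0 < env.gap j m →
      η * (2 + c j m + c j m') ≤ env.gap j m / 100 := by
    simp only [eventually_all]
    intro j m m' hgap
    have hcont : Tendsto (fun η : ℝ => η * (2 + c j m + c j m')) (nhdsWithin 0 (Set.Ioi 0))
        (nhds (0 * (2 + c j m + c j m'))) :=
      ((continuous_id.mul continuous_const).tendsto 0).mono_left nhdsWithin_le_nhds
    rw [zero_mul] at hcont
    exact hcont.eventually_le_const (by positivity)
  obtain ⟨η, h1, h2⟩ := (h.and self_mem_nhdsWithin).exists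
  exact ⟨η, h2, h1⟩

lemma eventually_biased_le (env : Environment A M k k' d d') (h : History A M) {C : ℝ}
    (hC : 0 < C) :
    ∀ᶠ n : ℕ in atTop, 20 * bias env h ≤ √(4 * Real.log n) ∧ 25 * Real.log d ≤ Real.log n ∧
      (h.length : ℝ) < C * Real.log n := by
  have hlog : Tendsto (fun n : ℕ => Real.log n) atTop atTop :=
    Real.tendsto_log_atTop.comp tendsto_natCast_atTop_atTop
  have h1 : Tendsto (fun n : ℕ => √(4 * Real.log n)) atTop atTop :=
    Real.tendsto_sqrt_atTop.comp (hlog.const_mul_atTop (by norm_num))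
  exact (h1.eventually_ge_atTop _).and ((hlog.eventually_ge_atTop _).and
    ((hlog.const_mul_atTop hC).eventually_gt_atTop _))

/-- Dropping the horizon makes the bound uniform in `T`. -/
lemma regret_le {o : A → Bool} {ε : A × M × ℕ → ℝ} {x : ArrivalPath A} {h : History A M} (j : A)
    (T : ℝ) :
    regret env Γ s o ε x h j T ≤ ∑ m, ENNReal.ofReal (env.gap j m) *
      ∑' t, (if (recordAt env Γ s o ε x h t).user = j ∧ (recordAt env Γ s o ε x h t).arm = m
        then 1 else 0 : ℝ≥0∞) := by
  simp only [← ENNReal.tsum_mul_left]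
  rw [← Summable.tsum_finsetSum fun _ _ => ENNReal.summable]
  refine ENNReal.tsum_le_tsum fun t => ?_
  change (if (recordAt env Γ s o ε x h t).user = j ∧ (recordAt env Γ s o ε x h t).time ≤ T then
    ENNReal.ofReal (env.gap j (recordAt env Γ s o ε x h t).arm) else 0) ≤ _
  split_ifs with ht
  · refine le_trans ?_ (Finset.single_le_sum (fun _ _ => zero_le)
      (Finset.mem_univ (recordAt env Γ s o ε x h t).arm))
    simp [ht.1]
  · exact zero_le

/-- The expected regret is bounded in every subgame in which the arrivals of the users are not too
late. -/
lemma exists_expRegret_le [MeasurableSpace A] (hA : Assumptions env Γ c s)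
    {D : A → M → Finset A} (hDcard : ∀ j m, 0 < env.gap j m → (D j m).card = d)
    (hjD : ∀ j m, 0 < env.gap j m → j ∉ D j m)
    (hD : ∀ j m, 0 < env.gap j m → ∀ i ∈ D j m, i ∈ optimalFor env m)
    (hB : ∀ j m, 0 < env.gap j m → ∀ i ∈ D j m,
      0 < ∑ m' ∈ Finset.univ.erase m, 16 / env.gap i m' ^ 2)
    {W : A → M → ArrivalPath A → ℝ≥0∞} (hW : ∀ j m, Measurable (W j m))
    (hWle : ∀ j m x, ∑ i ∈ D j m, ∑' r : ℕ,
      (lateArrivals (16 * c j m ^ 2 / env.gap j m ^ 2) i j r).indicator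
        (fun _ => (r : ℝ≥0∞) + 2) x ≤ W j m x)
    (ν : Measure ℝ) [IsProbabilityMeasure ν] (hν : HasSubgaussianMGF (fun e : ℝ => e) 1 ν)
    (Q : Measure (ArrivalPath A)) [IsProbabilityMeasure Q]
    (hreg : ∀ᵐ x ∂Q, ArrivalPath.Regular x)
    (hWQ : ∀ j m, 0 < env.gap j m → ∫⁻ x, W j m x ∂Q ≠ ⊤) (o : A → Bool) (h : History A M)
    (hmatch : ∀ᵐ x ∂Q, MatchesPath x h) (j : A) :
    ∃ K : ℝ≥0∞, K < ⊤ ∧ ∀ T, expRegret env Γ Q ν s o h j T ≤ K := by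
  obtain ⟨η, hη⟩ := exists_smallWidth env c
  let a : A → M → ℕ := fun i m => (ownRewards (ownRecords h i) m).length
  set μ := Measure.infinitePi fun _ : A × M × ℕ => ν with hμ
  let F := concentrationFailures a η
  have hFm : Measurable F := measurable_concentrationFailures a η
  have hF : ∫⁻ ε, F ε ∂μ < ⊤ := lintegral_concentrationFailures_lt_top ν hν a hη.1
  have hbound : ∀ m, ∃ K K' : ℝ≥0, ∀ ε x, x.Regular → MatchesPath x h →
      ENNReal.ofReal (env.gap j m) *
        ∑' t, (if (recordAt env Γ s o ε x h t).user = j ∧ (recordAt env Γ s o ε x h t).arm = m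
          then 1 else 0 : ℝ≥0∞) ≤ ENNReal.ofReal (env.gap j m) * (K * (F ε + K') + K * W j m x) := by
    intro m
    rcases le_or_gt (env.gap j m) 0 with hgap | hgap
    · exact ⟨0, 0, fun ε x _ _ => by simp [ENNReal.ofReal_of_nonpos hgap]⟩
    have hC : 0 < 19 / 20 * (16 * c j m ^ 2 / env.gap j m ^ 2) := by
      have := hA.coefPos j m; positivity
    obtain ⟨n₀, hn₀⟩ := (eventually_biased_le env h hC).exists_forall_of_atTop
    obtain ⟨K, hK⟩ := exists_tsum_pulls_le hA hη hgap (hDcard j m hgap) (hjD j m hgap)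
      (hD j m hgap) (hB j m hgap) o h
    -- The coefficient `K + 1` is nonzero, so the bound is `⊤` and holds trivially where the number
    -- of failures is infinite.
    refine ⟨K + 1, n₀ + 2, fun ε x hx hxh => ?_⟩
    gcongr
    by_cases hFtop : F ε = ⊤
    · simp [hFtop]
    obtain ⟨z, hz, hzcon⟩ := exists_forall_concentrated hFtop
    refine (hK ε x (z + n₀) (fun n hn => ?_) (fun n hn => (hn₀ n (by omega)).2.2) hx hxh).trans ?_
    · exact ⟨(hn₀ n (by omega)).1, (hn₀ n (by omega)).2.1, hzcon n (by omega)⟩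
    · have hK1 : (K : ℝ≥0∞) ≤ (K + 1 : ℝ≥0) := by push_cast; exact le_self_add
      refine add_le_add (mul_le_mul' hK1 ?_) (mul_le_mul' hK1 (hWle j m x))
      calc (1 : ℝ≥0∞) + (z + n₀ : ℕ) = z + (n₀ + 1) := by push_cast; ring
        _ ≤ F ε + 1 + (n₀ + 1) := by gcongr
        _ = F ε + (n₀ + 2 : ℝ≥0) := by push_cast; ring
  choose K K' hKK' using hbound
  refine ⟨∫⁻ z, ∑ m, ENNReal.ofReal (env.gap j m) *
    (K m * (F z.2 + K' m) + K m * W j m z.1) ∂(Q.prod μ), ?_, fun T => ?_⟩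
  · have hm1 : Measurable fun z : ArrivalPath A × (A × M × ℕ → ℝ) => F z.2 := hFm.comp measurable_snd
    have hm2 : ∀ m, Measurable fun z : ArrivalPath A × (A × M × ℕ → ℝ) => W j m z.1 :=
      fun m => (hW j m).comp measurable_fst
    have hI1 : ∫⁻ z, F z.2 ∂(Q.prod μ) = ∫⁻ ε, F ε ∂μ := measurePreserving_snd.lintegral_comp hFm
    have hI2 : ∀ m, ∫⁻ z, W j m z.1 ∂(Q.prod μ) = ∫⁻ x, W j m x ∂Q :=
      fun m => measurePreserving_fst.lintegral_comp (hW j m)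
    rw [lintegral_finsetSum _ fun m _ => by have := hm2 m; fun_prop]
    refine ENNReal.sum_lt_top.2 fun m _ => ?_
    rw [lintegral_const_mul _ (by have := hm2 m; fun_prop)]
    rcases le_or_gt (env.gap j m) 0 with hgap | hgap
    · simp [ENNReal.ofReal_of_nonpos hgap]
    rw [lintegral_add_right _ ((hm2 m).const_mul _), lintegral_const_mul _ (by fun_prop),
      lintegral_const_mul _ (hm2 m), lintegral_add_right _ measurable_const, hI1, hI2]
    have := hWQ j m hgap
    have := hF.ne
    simp only [lintegral_const, measure_univ, mul_one]
    finiteness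
  · refine lintegral_mono_ae ?_
    filter_upwards [Measure.quasiMeasurePreserving_fst.ae hreg,
      Measure.quasiMeasurePreserving_fst.ae hmatch] with z hz1 hz2
    exact (regret_le j T).trans (Finset.sum_le_sum fun m _ => hKK' m z.2 z.1 hz1 hz2)

end Regret

/-! ### Subgames -/

section Subgames

variable {A M : Type} [DecidableEq A]

lemma Follows.matchesPath {x : ArrivalPath A} {h : History A M} {l : ℕ}
    (hf : Follows (fun n : Fin l => x n) h) : MatchesPath x h := by
  intro i
  have htake : (List.ofFn fun n : Fin l => x n).take h.length = (List.range h.length).map x := by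
    refine List.ext_getElem (by simp [hf.1]) fun n h1 h2 => ?_
    simp
  have h1 : (h.map fun r => r.user).reverse = (List.range h.length).map fun t => (x t).1 := by
    have := congrArg (List.map Prod.fst) (hf.2.2.trans htake)
    simpa [List.map_reverse, Function.comp_def] using this
  have h2 := congrArg (List.countP fun u => decide (u = i)) h1
  rw [List.countP_reverse, List.countP_map, List.countP_map] at h2
  rw [ownRecords, ← List.countP_eq_length_filter]
  exact h2

lemma matchesPath_nil (x : ArrivalPath A) : MatchesPath x ([] : History A M) := fun _ => rfl

variable [Fintype A] [Nonempty A] [MeasurableSpace A] [DiscreteMeasurableSpace A]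
  {P : Measure (ArrivalPath A)} [IsProbabilityMeasure P]

lemma measurable_initialArrivals_pair (l : ℕ) :
    Measurable fun x : ArrivalPath A => (fun n : Fin l => x n, x) :=
  (measurable_pi_lambda _ fun n : Fin l => measurable_pi_apply (n : ℕ)).prodMk measurable_id

instance isMarkovKernel_condArrivals (l : ℕ) : IsMarkovKernel (condArrivals P l) := by
  unfold condArrivals
  infer_instance

lemma map_compProd_condArrivals (l : ℕ) :
    (P.map fun (x : ArrivalPath A) (n : Fin l) => x n) ⊗ₘ condArrivals P l =
      P.map fun x => (fun n : Fin l => x n, x) :=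
  compProd_map_condDistrib aemeasurable_id

/-- Almost sure properties disintegrate along the joint law of the first `l` arrivals and the path,
which lives on the graph of the restriction map. -/
lemma ae_condArrivals (l : ℕ) {p : ArrivalPath A → Prop} (hp : ∀ᵐ x ∂P, p x) :
    ∀ᵐ y ∂(P.map fun (x : ArrivalPath A) (n : Fin l) => x n), ∀ᵐ x ∂(condArrivals P l y),
      p x ∧ (fun n : Fin l => x n) = y := by
  have hf := measurable_initialArrivals_pair (A := A) l
  have hq : Measure.QuasiMeasurePreserving Prod.snd
      (P.map fun x => (fun n : Fin l => x n, x)) P := by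
    refine ⟨measurable_snd, ?_⟩
    rw [Measure.map_map measurable_snd hf]
    exact (Measure.map_id (μ := P)).absolutelyContinuous
  have h2 : ∀ᵐ q ∂(P.map fun x => (fun n : Fin l => x n, x)),
      (fun n : Fin l => q.2 n) = q.1 := by
    have hm : MeasurableSet {q : (Fin l → A × ℝ) × ArrivalPath A |
        (fun n : Fin l => q.2 n) = q.1} :=
      measurableSet_eq_fun (hf.fst.comp measurable_snd) measurable_fst
    exact (ae_map_iff hf.aemeasurable hm).2 (ae_of_all _ fun x => rfl)
  refine Measure.ae_ae_of_ae_compProd (p := fun q => p q.2 ∧ (fun n : Fin l => q.2 n) = q.1) ?_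
  rw [map_compProd_condArrivals]
  filter_upwards [hq.ae hp, h2] with q h3 h4 using ⟨h3, h4⟩

lemma ae_lintegral_condArrivals_ne_top (l : ℕ) {W : ArrivalPath A → ℝ≥0∞} (hW : Measurable W)
    (hWP : ∫⁻ x, W x ∂P ≠ ⊤) :
    ∀ᵐ y ∂(P.map fun (x : ArrivalPath A) (n : Fin l) => x n),
      ∫⁻ x, W x ∂(condArrivals P l y) ≠ ⊤ := by
  have hf := measurable_initialArrivals_pair (A := A) l
  have h1 : ∫⁻ y, ∫⁻ x, W x ∂(condArrivals P l y)
      ∂(P.map fun (x : ArrivalPath A) (n : Fin l) => x n) = ∫⁻ x, W x ∂P := by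
    rw [← Measure.lintegral_compProd (f := fun q => W q.2) (hW.comp measurable_snd),
      map_compProd_condArrivals]
    exact lintegral_map (hW.comp measurable_snd) hf
  have h2 := ae_lt_top (μ := P.map fun (x : ArrivalPath A) (n : Fin l) => x n)
    hW.lintegral_kernel (h1.trans_ne hWP)
  filter_upwards [h2] with y hy using hy.ne

end Subgames

/-! ### The theorem -/

section Main

variable {A M : Type} [Fintype A] [DecidableEq A] [Nonempty A] [MeasurableSpace A]
  [DiscreteMeasurableSpace A] [Fintype M] [DecidableEq M] {k k' d d' : ℕ}
  {env : Environment A M k k' d d'} {Γ : Mechanism A M k} {c : A → M → ℝ}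
  {s : A → Strategy A M}

/-- For `d = 0` the oracle assumption applies to the empty set and writes every mean as an empty
sum. -/
lemma Environment.gap_eq_zero_of_dim_zero {env : Environment A M k k' 0 d'}
    (hsco : Γ.SCOAssumption env) (j : A) (m : M) : env.gap j m = 0 := by
  have hmean : ∀ n, env.mean j n = 0 := fun n => by
    simpa using hsco n ∅ j (by simp) (Nat.zero_le _) fun _ => []
  have : Nonempty M := ⟨m⟩
  simp [Environment.gap, hmean]

/-- For every suboptimal arm there are `d` users from whom it can be learned. -/
lemma exists_comparison_users {P : Measure (ArrivalPath A)} (harr : ArrivalAssumption env c P)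
    {j : A} {m : M} (hgap : 0 < env.gap j m) :
    ∃ D : Finset A, D.card = d ∧ j ∉ D ∧ (∀ i ∈ D, i ∈ comparable env c P j m) ∧
      ∀ i ∈ D, i ∈ optimalFor env m := by
  obtain ⟨D, hD, hcard⟩ := Set.exists_subset_card_eq (harr j m hgap)
  have hfin : D.Finite := Set.toFinite D
  refine ⟨hfin.toFinset, by rw [← hcard, Set.ncard_eq_toFinset_card D hfin], ?_, ?_, ?_⟩
  · intro hj
    exact (hD (hfin.mem_toFinset.1 hj)).1.1 rfl
  · exact fun i hi => (hD (hfin.mem_toFinset.1 hi)).1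
  · exact fun i hi => (hD (hfin.mem_toFinset.1 hi)).2

lemma sum_inv_sq_gap_pos {i j : A} {m : M} (hgap : 0 < env.gap j m) (hi : i ∈ optimalFor env m) :
    0 < ∑ n ∈ Finset.univ.erase m, 16 / env.gap i n ^ 2 := by
  have : Nonempty M := ⟨m⟩
  obtain ⟨n, hn⟩ := exists_eq_ciSup_of_finite (f := fun n => env.mean j n)
  have hnm : n ≠ m := by
    rintro rfl
    rw [Environment.gap, ← hn, sub_self] at hgap
    exact lt_irrefl _ hgap
  refine Finset.sum_pos (fun n' hn' => ?_) ⟨n, Finset.mem_erase.2 ⟨hnm, Finset.mem_univ n⟩⟩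
  have := gap_pos_of_mem_optimalFor hi (Finset.ne_of_mem_erase hn')
  positivity

lemma bounded_expRegret (ν : Measure ℝ) [IsProbabilityMeasure ν]
    (hν : HasSubgaussianMGF (fun e : ℝ => e) 1 ν) (P : Measure (ArrivalPath A))
    [IsProbabilityMeasure P] (hPreg : ∀ᵐ x ∂P, ArrivalPath.Regular x)
    (hPind : IndependentArrivals P) (hA : Assumptions env Γ c s)
    (harr : ArrivalAssumption env c P) :
    (∀ o j, ∃ K : ℝ≥0∞, K < ⊤ ∧ ∀ T, expRegret env Γ P ν s o [] j T ≤ K) ∧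
      InEverySubgame env Γ P fun Q o h =>
        ∀ j, ∃ K : ℝ≥0∞, K < ⊤ ∧ ∀ T, expRegret env Γ Q ν s o h j T ≤ K := by
  have hex : ∀ j m, ∃ D : Finset A, 0 < env.gap j m → D.card = d ∧ j ∉ D ∧
      (∀ i ∈ D, i ∈ comparable env c P j m) ∧ ∀ i ∈ D, i ∈ optimalFor env m := by
    intro j m
    by_cases hgap : 0 < env.gap j m
    · obtain ⟨D, hD⟩ := exists_comparison_users harr hgap
      exact ⟨D, fun _ => hD⟩
    · exact ⟨∅, fun hgap' => absurd hgap' hgap⟩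
  choose D hD using hex
  let S : A → M → A → ℕ → Set (ArrivalPath A) := fun j m i r =>
    lateArrivals (16 * c j m ^ 2 / env.gap j m ^ 2) i j r
  -- Measurable hulls under `P` avoid proving that the late-arrival events are measurable. They
  -- preserve `P`-probabilities, and under the conditional laws only the pointwise domination is
  -- used.
  let W : A → M → ArrivalPath A → ℝ≥0∞ := fun j m x =>
    ∑ i ∈ D j m, ∑' r : ℕ, (toMeasurable P (S j m i r)).indicator (fun _ => (r : ℝ≥0∞) + 2) x
  have hmeas : ∀ j m i r,
      Measurable ((toMeasurable P (S j m i r)).indicator fun _ => (r : ℝ≥0∞) + 2) :=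
    fun j m i r => measurable_const.indicator (measurableSet_toMeasurable P _)
  have hW : ∀ j m, Measurable (W j m) := fun j m =>
    Finset.measurable_fun_sum _ fun i _ => Measurable.tsum fun r => hmeas j m i r
  have hWle : ∀ j m x, ∑ i ∈ D j m, ∑' r : ℕ,
      (S j m i r).indicator (fun _ => (r : ℝ≥0∞) + 2) x ≤ W j m x := fun j m x =>
    Finset.sum_le_sum fun i _ => ENNReal.tsum_le_tsum fun r =>
      Set.indicator_le_indicator_of_subset (subset_toMeasurable P _) (fun _ => zero_le) x
  have hB : ∀ j m, 0 < env.gap j m → ∀ i ∈ D j m,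
      0 < ∑ m' ∈ Finset.univ.erase m, 16 / env.gap i m' ^ 2 := fun j m hgap i hi =>
    sum_inv_sq_gap_pos hgap ((hD j m hgap).2.2.2 i hi)
  have hWP : ∀ j m, 0 < env.gap j m → ∫⁻ x, W j m x ∂P ≠ ⊤ := by
    intro j m hgap
    rw [lintegral_finsetSum _ fun i _ => Measurable.tsum fun r => hmeas j m i r]
    refine ENNReal.sum_ne_top.2 fun i hi => ?_
    rw [lintegral_tsum fun r => (hmeas j m i r).aemeasurable]
    simp only [lintegral_indicator_const (measurableSet_toMeasurable P _), measure_toMeasurable]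
    exact tsum_measure_lateArrivals_ne_top hPreg hPind hA.dim_pos (hA.coefPos j m) hgap
      (hB j m hgap i hi) ((hD j m hgap).2.2.1 i hi)
  have hmain := fun (Q : Measure (ArrivalPath A)) [IsProbabilityMeasure Q] =>
    exists_expRegret_le hA (fun j m hgap => (hD j m hgap).1) (fun j m hgap => (hD j m hgap).2.1)
      (fun j m hgap => (hD j m hgap).2.2.2) hB hW hWle ν hν Q
  refine ⟨fun o j => hmain P hPreg hWP o [] (ae_of_all _ matchesPath_nil) j, fun l => ?_⟩
  have hWQ : ∀ᵐ y ∂(P.map fun (x : ArrivalPath A) (n : Fin l) => x n), ∀ j m,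
      0 < env.gap j m → ∫⁻ x, W j m x ∂(condArrivals P l y) ≠ ⊤ := by
    simp only [ae_all_iff]
    exact fun j m hgap => ae_lintegral_condArrivals_ne_top l (hW j m) (hWP j m hgap)
  filter_upwards [hWQ, ae_condArrivals l hPreg] with y hy1 hy2 o h _ hfol j
  refine hmain _ (hy2.mono fun x hx => hx.1) hy1 o h (hy2.mono fun x hx => ?_) j
  exact Follows.matchesPath (l := l) (hx.2 ▸ hfol)

lemma AsymptoticallyIndifferent.pref_of_bounded {pref : Preference}
    (hpref : AsymptoticallyIndifferent pref) {f g : ℝ → ℝ≥0∞}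
    (hf : ∃ K : ℝ≥0∞, K < ⊤ ∧ ∀ T, f T ≤ K) : pref f g := by
  obtain ⟨K, hK, hfK⟩ := hf
  lift K to ℝ≥0 using hK.ne
  refine (hpref f g).2 ⟨K, Eventually.of_forall fun T => (hfK T).trans ?_⟩
  exact le_mul_of_one_le_right' (le_max_left _ _)

lemma expRegret_eq_zero_of_dim_zero {env : Environment A M k k' 0 d'}
    (hsco : Γ.SCOAssumption env) (ν : Measure ℝ) [IsProbabilityMeasure ν]
    (Q : Measure (ArrivalPath A)) (o : A → Bool) (h : History A M) (j : A) (T : ℝ) :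
    expRegret env Γ Q ν s o h j T = 0 := by
  simp [expRegret, regret, Environment.gap_eq_zero_of_dim_zero hsco]

end Main

end CFUCB

theorem theorem2 {A M : Type} [Fintype A] [DecidableEq A] [Nonempty A]
    [MeasurableSpace A] [DiscreteMeasurableSpace A]
    [Fintype M] [DecidableEq M] [Nonempty M]
    {k k' d d' : ℕ}
    (env : CFUCB.Environment A M k k' d d')
    (Γ : CFUCB.Mechanism A M k)
    -- law of the noise
    (ν : MeasureTheory.Measure ℝ) [MeasureTheory.IsProbabilityMeasure ν]
    (hν0 : ∫ e, e ∂ν = 0)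
    (hν : ProbabilityTheory.HasSubgaussianMGF (fun e : ℝ => e) 1 ν)
    -- law of the arrival process
    (P : MeasureTheory.Measure (CFUCB.ArrivalPath A)) [MeasureTheory.IsProbabilityMeasure P]
    (hPreg : ∀ᵐ x ∂P, CFUCB.ArrivalPath.Regular x)
    (hPind : CFUCB.IndependentArrivals P)
    -- synthetic control oracle and choice of the comparison users
    (hpos : env.GeneralPosition)
    (hsco : Γ.SCOAssumption env)
    (hsel : CFUCB.Mechanism.ValidSelection d Γ)
    (c : A → M → ℝ) (hc0 : ∀ j m, 0 < c j m) (hc : Γ.CoefBound env c)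
    -- arrival assumption
    (harr : CFUCB.ArrivalAssumption env c P)
    -- users with asymptotically indifferent preferences
    (pref : A → CFUCB.Preference)
    (hpref : ∀ i, CFUCB.AsymptoticallyIndifferent (pref i))
    -- the profile in which every user opts in and complies
    (s : A → CFUCB.Strategy A M) (hs : ∀ i, (s i).Complies) :
    CFUCB.IsSPNE env Γ P ν pref s ∧
    (∀ i, ∃ K : ENNReal, K < ⊤ ∧
      ∀ T, CFUCB.expRegret env Γ P ν s (fun j => (s j).init) [] i T ≤ K) ∧
    CFUCB.InEverySubgame env Γ P (fun Q o h =>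
      ∀ i, ∃ K : ENNReal, K < ⊤ ∧ ∀ T, CFUCB.expRegret env Γ Q ν s o h i T ≤ K) := by
  have hbdd : (∀ o i, ∃ K : ENNReal, K < ⊤ ∧ ∀ T, CFUCB.expRegret env Γ P ν s o [] i T ≤ K) ∧
      CFUCB.InEverySubgame env Γ P (fun Q o h =>
        ∀ i, ∃ K : ENNReal, K < ⊤ ∧ ∀ T, CFUCB.expRegret env Γ Q ν s o h i T ≤ K) := by
    -- The main argument needs a nonempty set of comparison users; for `d = 0` all gaps vanish and
    -- there is no regret.
    rcases Nat.eq_zero_or_pos d with rfl | hd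
    · have h0 := CFUCB.expRegret_eq_zero_of_dim_zero (s := s) hsco ν
      exact ⟨fun o i => ⟨0, ENNReal.zero_lt_top, fun T => (h0 P o [] i T).le⟩,
        fun l => ae_of_all _ fun p o h _ _ i =>
          ⟨0, ENNReal.zero_lt_top, fun T => (h0 _ o h i T).le⟩⟩
    · exact CFUCB.bounded_expRegret ν hν P hPreg hPind ⟨hpos, hsco, hsel, hc0, hc, hs, hd⟩ harr
  refine ⟨⟨fun i dev => (hpref i).pref_of_bounded (hbdd.1 _ i), fun l => ?_⟩,
    fun i => hbdd.1 _ i, hbdd.2⟩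
  filter_upwards [hbdd.2 l] with p hp o h hfeas hfol i dev
  exact (hpref i).pref_of_bounded (hp o h hfeas hfol i)
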